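/- Let $d\ge 1$ and $L_1,\dots,L_d\ge 1$ be integers, and let $\Omega=\prod_{i=1}^d \mathbf{Z}/L_i\mathbf{Z}$ be the discrete torus, on which $\mathbf{Z}^d$ acts by the translations $\tau_n\omega=\omega+n$. Call $b:\Omega\to\mathbf{R}$ admissible if $\sup_\omega|b(\omega)|<\frac1{2d}$ and $$b(x_1,x_2,\dots,x_d)=-b(L_1-1-x_1,x_2,\dots,x_d),\qquad x\in\Omega .$$ For $\varepsilon>0$ and $f:\mathbf{R}^d\to\mathbf{R}$ smooth with compact support, let $u_\varepsilon$ be the bounded solution on $\varepsilon\mathbf{Z}^d\times\Omega$ of $$u_\varepsilon(x,\omega)-\sum_{i=1}^d\frac1{2d}\big[u_\varepsilon(x+\varepsilon\mathbf{e}_i,\omega)+u_\varepsilon(x-\varepsilon\mathbf{e}_i,\omega)\big]-b(\tau_{x/\varepsilon}\omega)\big[u_\varepsilon(x+\varepsilon\mathbf{e}_1,\omega)-u_\varepsilon(x-\varepsilon\mathbf{e}_1,\omega)\big]+\varepsilon^2u_\varepsilon(x,\omega)=\varepsilon^2f(x).$$ A number $q$ with $0<q<\infty$ is called an effective coefficient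 of $b$ if for every such $f$, with $u$ the bounded $C^2$ solution on $\mathbf{R}^d$ of $$-q\,\frac{\partial^2u}{\partial x_1^2}-\sum_{j=2}^d\frac1{2d}\frac{\partial^2u}{\partial x_j^2}+u=f,$$ one has $\lim_{\varepsilon\to0^+}\sup_{x\in\mathbf{R}^d,\ \omega\in\Omega}|u_\varepsilon(\varepsilon\lfloor x/\varepsilon\rfloor,\omega)-u(x)|=0$, where $\lfloor\cdot\rfloor$ is the integer part in each coordinate. **Theorem 1.2.** Every admissible $b$ has exactly one effective coefficient $q(b)$, and the following hold. (a) If $d=1$, then $q(b)\le\frac12$ for every admissible $b$. (b) If $d\ge1$ and $L_1=2$, then $q(b)\le\frac1{2d}$ for every admissible $b$. (c) If $d=2$ and $L_1=4$, then $q(b)\le\frac14$ for every admissible $b$. (d) If $d\ge2$, $L_1\ge6$ is even, and $L_j\ge2$ for at least one $j\ge2$, then there is an admissible $b$ with $q(b)>\frac1{2d}$. -/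

import Mathlib

open scoped Topology

namespace Homogenization

/-- The integer points of the torus `∏ [0, L i]` with periodic boundary conditions. The coordinate
`x₁` of the mathematical text is the coordinate with index `0 : Fin d`. -/
abbrev Torus {d : ℕ} (L : Fin d → ℕ) : Type :=
  (i : Fin d) → ZMod (L i)

/-- The translation `τ_n : Ω → Ω` by a lattice vector `n ∈ ℤ^d`. -/
def translate {d : ℕ} (L : Fin d → ℕ) (n : Fin d → ℤ) (ω : Torus L) : Torus L :=
  fun i => ω i + ((n i : ℤ) : ZMod (L i))

/-- The reflection `(x₁, x₂, …, x_d) ↦ (L₁ - 1 - x₁, x₂, …, x_d)`. -/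
def reflect {d : ℕ} [NeZero d] (L : Fin d → ℕ) (ω : Torus L) : Torus L :=
  Function.update ω 0 (((L 0 : ℕ) : ZMod (L 0)) - 1 - ω 0)

/-- The admissible drifts: `sup |b| < 1 / 2d` and `b` is antisymmetric under the reflection. -/
structure IsAdmissible {d : ℕ} [NeZero d] (L : Fin d → ℕ) (b : Torus L → ℝ) : Prop where
  abs_lt : ∀ ω, |b ω| < 1 / (2 * (d : ℝ))
  antisymm : ∀ ω, b ω = - b (reflect L ω)

/-- The point `ε n` of the scaled lattice `ε ℤ^d`. -/
noncomputable def latticePoint {d : ℕ} (ε : ℝ) (n : Fin d → ℤ) : EuclideanSpace ℝ (Fin d) :=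
  WithLp.toLp 2 (fun i => ε * (n i : ℝ))

/-- `U` is a bounded solution of the difference equation on `ε ℤ^d` with drift `b` and right-hand
side `ε² f`; here `U n ω` is the value `u_ε(ε n, ω)`. For `ε > 0`, `|b| < 1 / 2d` and bounded `f`
there is exactly one such `U`. -/
structure IsDiscreteSolution {d : ℕ} [NeZero d] (L : Fin d → ℕ) (b : Torus L → ℝ)
    (f : EuclideanSpace ℝ (Fin d) → ℝ) (ε : ℝ)
    (U : (Fin d → ℤ) → Torus L → ℝ) : Prop where
  bounded : ∃ C : ℝ, ∀ n ω, |U n ω| ≤ C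
  equation : ∀ n ω,
    U n ω
      - ∑ i : Fin d, 1 / (2 * (d : ℝ)) * (U (n + Pi.single i 1) ω + U (n - Pi.single i 1) ω)
      - b (translate L n ω) * (U (n + Pi.single 0 1) ω - U (n - Pi.single 0 1) ω)
      + ε ^ 2 * U n ω
    = ε ^ 2 * f (latticePoint ε n)

/-- The second partial derivative `∂² u / ∂ x_j²` at `x`. -/
noncomputable def secondPartial {d : ℕ} (j : Fin d) (u : EuclideanSpace ℝ (Fin d) → ℝ)
    (x : EuclideanSpace ℝ (Fin d)) : ℝ :=
  lineDeriv ℝ (fun y => lineDeriv ℝ u y (EuclideanSpace.single j 1)) x (EuclideanSpace.single j 1)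

/-- `u` is a bounded classical solution on `ℝ^d` of
`- q ∂²u/∂x₁² - ∑_{j ≥ 2} (1 / 2d) ∂²u/∂x_j² + u = f`. For `q > 0` and smooth compactly supported
`f` there is exactly one such `u`. -/
structure IsHomogenizedSolution {d : ℕ} [NeZero d] (q : ℝ) (f u : EuclideanSpace ℝ (Fin d) → ℝ) :
    Prop where
  contDiff : ContDiff ℝ 2 u
  bounded : ∃ C : ℝ, ∀ x, |u x| ≤ C
  equation : ∀ x,
    - q * secondPartial 0 u x
      - ∑ j ∈ Finset.univ.erase (0 : Fin d), 1 / (2 * (d : ℝ)) * secondPartial j u x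
      + u x
    = f x

/-- `q` is the effective (homogenized) coefficient of the drift `b`: `0 < q < ∞`, and for every
smooth compactly supported `f` the bounded solutions `u_ε` of the difference equations and the
bounded solution `u` of the homogenized equation satisfy
`sup_{x, ω} |u_ε(ε ⌊x / ε⌋, ω) - u(x)| → 0` as `ε → 0⁺`. -/
def IsEffectiveCoefficient {d : ℕ} [NeZero d] (L : Fin d → ℕ) (b : Torus L → ℝ) (q : ℝ) : Prop :=
  0 < q ∧
  ∀ f : EuclideanSpace ℝ (Fin d) → ℝ, ContDiff ℝ ((⊤ : ℕ∞) : WithTop ℕ∞) f → HasCompactSupport f →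
    ∃ (u : EuclideanSpace ℝ (Fin d) → ℝ) (U : ℝ → (Fin d → ℤ) → Torus L → ℝ),
      IsHomogenizedSolution q f u ∧
      (∀ ε : ℝ, 0 < ε → IsDiscreteSolution L b f ε (U ε)) ∧
      TendstoUniformly
        (fun (ε : ℝ) (p : EuclideanSpace ℝ (Fin d) × Torus L) =>
          U ε (fun i => ⌊p.1 i / ε⌋) p.2)
        (fun p => u p.1)
        (𝓝[>] (0 : ℝ))

end Homogenization

/-! Everything is reduced to linear algebra on the finite torus. Let A = `cellOp L b` be the
generator I - P of the environment seen from the walk. By the maximum principle the kernel of A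
consists of the constants, so A χ = g - c is solvable for exactly one constant c. The reflection
conjugates A to itself, because it exchanges the steps ±e₁ and changes the sign of `b`; hence c = 0
for antisymmetric g. This gives ψ with A ψ = 2b, so that x₁ + ψ is harmonic for the walk. The number
q is read off from the constant in the equation for χ₀ (`exists_isCorrector`), and it is positive
because it is an averaged energy of x₁ + ψ.

Existence: if u is a Schwartz solution of the homogenized equation, then u + ε ψ ∂₁u + ε² ∑ χ_i
∂_i∂₁u solves the difference equation up to O(ε³) (`IsCorrector.exists_residual_le`), and the
discrete maximum principle turns this into a uniform error O(ε). Uniqueness: discrete solutions are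
unique, so two coefficients would share one limit u; then ∂₁²u = 0, and u and f would be constant
along x₁, which compact support excludes.

The inequalities are statements about correctors. In dimension one the invariant density is
explicit, and (a) becomes the inequality between harmonic and arithmetic means. For (b), the steps
+e₁ and -e₁ both coincide with the reflection, and 1/(2d) - q is a mean Dirichlet form. For (c), the
two neighbours of a point along e₁ are its reflection and its image under another involution S;
(anti)symmetry removes the reflection, and `nonneg_of_involution` settles the remaining problem by
quadratic forms. For (d), put b = ηβ with β a plane wave. Then q - 1/(2d) is 2η²/|Ω| times a
quantity continuous at η = 0 (`IsCorrector.card_mul_sub_eq`). With κ, ς the cosines of the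
frequencies along e₁ and e_j, its value at 0 has the sign of 2κ - 1 - κς, which is positive when κ ≥
1/2 and ς < 0. -/

namespace Homogenization

/-! ### Cell problems on the torus and the correctors -/

section Cell

variable {d : ℕ} {L : Fin d → ℕ}

/-- The unit vector of the torus in the direction `i`. -/
def unitVec (L : Fin d → ℕ) (i : Fin d) : Torus L := Pi.single i 1

theorem translate_add_single (n : Fin d → ℤ) (ω : Torus L) (i : Fin d) :
    translate L (n + Pi.single i 1) ω = translate L n ω + unitVec L i := by
  funext j
  rcases eq_or_ne j i with rfl | h
  · simp [translate, unitVec, add_assoc]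
  · simp [translate, unitVec, h]

theorem translate_sub_single (n : Fin d → ℤ) (ω : Torus L) (i : Fin d) :
    translate L (n - Pi.single i 1) ω = translate L n ω - unitVec L i := by
  have h := translate_add_single (n - Pi.single i 1) ω i
  rw [sub_add_cancel] at h
  rw [h, add_sub_cancel_right]

/-- A set of torus points closed under all positive unit steps is empty or everything. -/
theorem forall_of_closed_add_unitVec [∀ i, NeZero (L i)] {p : Torus L → Prop} {ω₀ : Torus L}
    (h₀ : p ω₀) (hstep : ∀ i ω, p ω → p (ω + unitVec L i)) (ω : Torus L) : p ω := by
  -- In a finite cyclic group every element is a natural multiple of 1, so the positive unit steps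
  -- already generate the torus as a monoid.
  let S : AddSubmonoid (Torus L) :=
    { carrier := {v | ∀ ω, p ω → p (ω + v)}
      zero_mem' := by intro ω h; simpa using h
      add_mem' := by
        intro v w hv hw ω h
        rw [← add_assoc]
        exact hw _ (hv _ h) }
  have hS : ∀ v : Torus L, v ∈ S := by
    intro v
    rw [← Finset.univ_sum_single v]
    refine S.sum_mem fun i _ => ?_
    have : Pi.single i (v i) = (v i).val • unitVec L i := by
      rw [unitVec, ← Pi.single_smul, nsmul_eq_mul, mul_one, ZMod.natCast_zmod_val]
    rw [this]
    exact S.nsmul_mem (hstep i) _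
  have := hS (ω - ω₀) ω₀ h₀
  rwa [add_sub_cancel] at this

theorem unitVec_same (i : Fin d) : unitVec L i i = 1 := Pi.single_eq_same _ _

theorem unitVec_ne {i j : Fin d} (h : j ≠ i) : unitVec L i j = 0 := Pi.single_eq_of_ne h _

variable [NeZero d]

/-- The generator `I - P` of the environment process with drift `b`. -/
noncomputable def cellOp (L : Fin d → ℕ) (b : Torus L → ℝ) :
    (Torus L → ℝ) →ₗ[ℝ] (Torus L → ℝ) where
  toFun ψ ω := ψ ω
    - ∑ i : Fin d, 1 / (2 * (d : ℝ)) * (ψ (ω + unitVec L i) + ψ (ω - unitVec L i))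
    - b ω * (ψ (ω + unitVec L 0) - ψ (ω - unitVec L 0))
  map_add' ψ χ := by
    funext ω
    simp only [Pi.add_apply, mul_add, Finset.sum_add_distrib]
    ring
  map_smul' c ψ := by
    funext ω
    simp only [Pi.smul_apply, smul_eq_mul, RingHom.id_apply, mul_add, Finset.sum_add_distrib,
      mul_left_comm _ c, ← Finset.mul_sum]
    ring

theorem cellOp_apply (b : Torus L → ℝ) (ψ : Torus L → ℝ) (ω : Torus L) :
    cellOp L b ψ ω = ψ ω
    - ∑ i : Fin d, 1 / (2 * (d : ℝ)) * (ψ (ω + unitVec L i) + ψ (ω - unitVec L i))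
    - b ω * (ψ (ω + unitVec L 0) - ψ (ω - unitVec L 0)) := rfl

theorem sum_inv_two_mul_dim (x : ℝ) : ∑ _i : Fin d, 1 / (2 * (d : ℝ)) * (2 * x) = x := by
  have hd : (d : ℝ) ≠ 0 := Nat.cast_ne_zero.2 (NeZero.ne d)
  rw [Finset.sum_const, Finset.card_univ, Fintype.card_fin, nsmul_eq_mul]
  field_simp

theorem cellOp_const (b : Torus L → ℝ) (c : ℝ) : cellOp L b (fun _ => c) = 0 := by
  funext ω
  rw [cellOp_apply]
  simp only [← two_mul, sum_inv_two_mul_dim]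
  simp

/-- The generator as a weighted sum of differences over the neighbours. -/
theorem cellOp_eq_sum_sub (b ψ : Torus L → ℝ) (ω : Torus L) :
    cellOp L b ψ ω = ∑ i : Fin d,
      ((1 / (2 * (d : ℝ)) + if i = 0 then b ω else 0) * (ψ ω - ψ (ω + unitVec L i))
      + (1 / (2 * (d : ℝ)) - if i = 0 then b ω else 0) * (ψ ω - ψ (ω - unitVec L i))) := by
  rw [cellOp_apply]
  have h1 : ψ ω = ∑ _i : Fin d, 1 / (2 * (d : ℝ)) * (2 * ψ ω) := (sum_inv_two_mul_dim _).symm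
  have h2 : b ω * (ψ (ω + unitVec L 0) - ψ (ω - unitVec L 0))
      = ∑ i : Fin d, if i = 0 then b ω * (ψ (ω + unitVec L i) - ψ (ω - unitVec L i)) else 0 := by
    simp
  rw [h2]
  nth_rw 1 [h1]
  rw [← Finset.sum_sub_distrib, ← Finset.sum_sub_distrib]
  refine Finset.sum_congr rfl fun i _ => ?_
  split_ifs <;> ring

theorem reflect_apply_zero (ω : Torus L) : reflect L ω 0 = -1 - ω 0 := by
  simp [reflect]

theorem reflect_apply_ne (ω : Torus L) {i : Fin d} (hi : i ≠ 0) : reflect L ω i = ω i := by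
  simp [reflect, hi]

theorem reflect_reflect (ω : Torus L) : reflect L (reflect L ω) = ω := by
  funext i
  rcases eq_or_ne i 0 with rfl | hi
  · rw [reflect_apply_zero, reflect_apply_zero]; ring
  · rw [reflect_apply_ne _ hi, reflect_apply_ne _ hi]

theorem reflect_add_unitVec_zero (ω : Torus L) :
    reflect L (ω + unitVec L 0) = reflect L ω - unitVec L 0 := by
  funext j
  rcases eq_or_ne j 0 with rfl | hj
  · rw [reflect_apply_zero, Pi.sub_apply, Pi.add_apply, reflect_apply_zero, unitVec_same]; ring
  · rw [reflect_apply_ne _ hj, Pi.sub_apply, Pi.add_apply, reflect_apply_ne _ hj, unitVec_ne hj]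
    ring

theorem reflect_sub_unitVec_zero (ω : Torus L) :
    reflect L (ω - unitVec L 0) = reflect L ω + unitVec L 0 := by
  have := reflect_add_unitVec_zero (ω - unitVec L 0)
  rw [sub_add_cancel] at this
  rw [this, sub_add_cancel]

theorem reflect_add_unitVec (ω : Torus L) {i : Fin d} (hi : i ≠ 0) :
    reflect L (ω + unitVec L i) = reflect L ω + unitVec L i := by
  funext j
  rcases eq_or_ne j 0 with rfl | hj
  · rw [reflect_apply_zero, Pi.add_apply, Pi.add_apply, reflect_apply_zero, unitVec_ne hi.symm]
    ring
  · rw [reflect_apply_ne _ hj, Pi.add_apply, Pi.add_apply, reflect_apply_ne _ hj]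

theorem reflect_sub_unitVec (ω : Torus L) {i : Fin d} (hi : i ≠ 0) :
    reflect L (ω - unitVec L i) = reflect L ω - unitVec L i := by
  have := reflect_add_unitVec (ω - unitVec L i) hi
  rw [sub_add_cancel] at this
  rw [this, add_sub_cancel_right]

variable {b : Torus L → ℝ}

/-- The reflection exchanges the steps ±e₁ and changes the sign of `b`; the two effects cancel. This
symmetry is what makes the cell problem for the drift solvable. -/
theorem cellOp_comp_reflect (hb : IsAdmissible L b) (χ : Torus L → ℝ) (ω : Torus L) :
    cellOp L b (fun ω => χ (reflect L ω)) ω = cellOp L b χ (reflect L ω) := by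
  rw [cellOp_apply, cellOp_apply, reflect_add_unitVec_zero, reflect_sub_unitVec_zero,
    hb.antisymm ω]
  have : ∀ i : Fin d, χ (reflect L (ω + unitVec L i)) + χ (reflect L (ω - unitVec L i))
      = χ (reflect L ω + unitVec L i) + χ (reflect L ω - unitVec L i) := by
    intro i
    rcases eq_or_ne i 0 with rfl | hi
    · rw [reflect_add_unitVec_zero, reflect_sub_unitVec_zero, add_comm]
    · rw [reflect_add_unitVec _ hi, reflect_sub_unitVec _ hi]
  simp only [this]
  ring

theorem weight_pos (hb : ∀ ω, |b ω| < 1 / (2 * (d : ℝ))) (ω : Torus L) (i : Fin d) :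
    0 < 1 / (2 * (d : ℝ)) + (if i = 0 then b ω else 0) ∧
    0 < 1 / (2 * (d : ℝ)) - (if i = 0 then b ω else 0) := by
  have h := abs_lt.1 (hb ω)
  have hd : (0 : ℝ) < 1 / (2 * (d : ℝ)) :=
    lt_of_le_of_lt (abs_nonneg _) (hb ω)
  split_ifs
  · constructor <;> linarith
  · simpa using hd

/-- The first order coupling `ψ ↦ 1/(2d) (ψ(ω + e_i) - ψ(ω - e_i)) + δ_{i1} b (ψ(ω + e_i) +
ψ(ω - e_i))` between the lattice and the torus variables. -/
noncomputable def driftOp (L : Fin d → ℕ) (b : Torus L → ℝ) (i : Fin d) (ψ : Torus L → ℝ)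
    (ω : Torus L) : ℝ :=
  1 / (2 * (d : ℝ)) * (ψ (ω + unitVec L i) - ψ (ω - unitVec L i))
    + if i = 0 then b ω * (ψ (ω + unitVec L 0) + ψ (ω - unitVec L 0)) else 0

theorem driftOp_zero (b ψ : Torus L → ℝ) (ω : Torus L) :
    driftOp L b 0 ψ ω = 1 / (2 * (d : ℝ)) * (ψ (ω + unitVec L 0) - ψ (ω - unitVec L 0))
      + b ω * (ψ (ω + unitVec L 0) + ψ (ω - unitVec L 0)) := by
  simp [driftOp]

/-- The first and second order correctors of the drift `b`, with effective coefficient `q`. -/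
structure IsCorrector (L : Fin d → ℕ) (b : Torus L → ℝ) (q : ℝ) (ψ : Torus L → ℝ)
    (χ : Fin d → Torus L → ℝ) : Prop where
  antisymm : ∀ ω, ψ (reflect L ω) = - ψ ω
  first : ∀ ω, cellOp L b ψ ω = 2 * b ω
  second : ∀ i ω, cellOp L b (χ i) ω =
    driftOp L b i ψ ω + if i = 0 then 1 / (2 * (d : ℝ)) - q else 0

/-- The energy density of the corrected coordinate `x₁ + ψ`. -/
noncomputable def energyDensity (L : Fin d → ℕ) (b ψ : Torus L → ℝ) (ω : Torus L) : ℝ :=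
  1 / 2 * ∑ i : Fin d,
    ((1 / (2 * (d : ℝ)) + if i = 0 then b ω else 0)
        * ((if i = 0 then 1 else 0) + ψ (ω + unitVec L i) - ψ ω) ^ 2
      + (1 / (2 * (d : ℝ)) - if i = 0 then b ω else 0)
        * ((if i = 0 then -1 else 0) + ψ (ω - unitVec L i) - ψ ω) ^ 2)

/-- Since x₁ + ψ is a martingale along the walk, its energy density is the generator applied to half
its square, up to the cross terms that χ₀ absorbs. Integrating against an invariant density shows
that q is the mean energy. -/
theorem IsCorrector.cellOp_sub_half_sq {q : ℝ} {ψ : Torus L → ℝ} {χ : Fin d → Torus L → ℝ}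
    (h : IsCorrector L b q ψ χ) (ω : Torus L) :
    cellOp L b (χ 0 - fun ω => 1 / 2 * ψ ω ^ 2) ω = energyDensity L b ψ ω - q := by
  have h1 := h.first ω
  have hsplit : energyDensity L b ψ ω = - cellOp L b (fun ω => 1 / 2 * ψ ω ^ 2) ω
      + ψ ω * cellOp L b ψ ω + driftOp L b 0 ψ ω - 2 * b ω * ψ ω + 1 / (2 * (d : ℝ)) := by
    rw [cellOp_eq_sum_sub, cellOp_eq_sum_sub, driftOp_zero]
    have h2 : 1 / (2 * (d : ℝ)) * (ψ (ω + unitVec L 0) - ψ (ω - unitVec L 0))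
        + b ω * (ψ (ω + unitVec L 0) + ψ (ω - unitVec L 0)) - 2 * b ω * ψ ω + 1 / (2 * (d : ℝ))
        = ∑ i : Fin d, if i = 0 then
          1 / (2 * (d : ℝ)) * (ψ (ω + unitVec L i) - ψ (ω - unitVec L i))
        + b ω * (ψ (ω + unitVec L i) + ψ (ω - unitVec L i)) - 2 * b ω * ψ ω
        + 1 / (2 * (d : ℝ)) else 0 := by simp
    have h3 : ∀ S T : ℝ, S + T
        + (1 / (2 * (d : ℝ)) * (ψ (ω + unitVec L 0) - ψ (ω - unitVec L 0))
        + b ω * (ψ (ω + unitVec L 0) + ψ (ω - unitVec L 0))) - 2 * b ω * ψ ω + 1 / (2 * (d : ℝ))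
        = S + T + (1 / (2 * (d : ℝ)) * (ψ (ω + unitVec L 0) - ψ (ω - unitVec L 0))
        + b ω * (ψ (ω + unitVec L 0) + ψ (ω - unitVec L 0)) - 2 * b ω * ψ ω
        + 1 / (2 * (d : ℝ))) := by intros; ring
    rw [h3, h2, energyDensity, Finset.mul_sum, Finset.mul_sum, ← Finset.sum_neg_distrib,
      ← Finset.sum_add_distrib, ← Finset.sum_add_distrib]
    refine Finset.sum_congr rfl fun i _ => ?_
    split_ifs <;> ring
  rw [map_sub, Pi.sub_apply, h.second, if_pos rfl, hsplit, h1]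
  ring

variable [∀ i, NeZero (L i)]

/-- Superharmonic functions on the torus are constant. -/
theorem eq_const_of_cellOp_nonneg (hb : ∀ ω, |b ω| < 1 / (2 * (d : ℝ))) {ψ : Torus L → ℝ}
    (h : ∀ ω, 0 ≤ cellOp L b ψ ω) : ∃ c : ℝ, ψ = fun _ => c := by
  obtain ⟨ω₀, hmin⟩ := Finite.exists_min ψ
  refine ⟨ψ ω₀, funext fun ω => ?_⟩
  refine forall_of_closed_add_unitVec (p := fun ω => ψ ω = ψ ω₀) rfl ?_ ω
  intro i ω hω
  have hA := h ω
  rw [cellOp_eq_sum_sub] at hA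
  have hterm : ∀ j ∈ (Finset.univ : Finset (Fin d)),
      ((1 / (2 * (d : ℝ)) + if j = 0 then b ω else 0) * (ψ ω - ψ (ω + unitVec L j))
      + (1 / (2 * (d : ℝ)) - if j = 0 then b ω else 0) * (ψ ω - ψ (ω - unitVec L j))) ≤ 0 := by
    intro j _
    obtain ⟨h1, h2⟩ := weight_pos hb ω j
    have := hmin (ω + unitVec L j)
    have := hmin (ω - unitVec L j)
    rw [hω]
    nlinarith
  have hz := (Finset.sum_eq_zero_iff_of_nonpos hterm).1
    (le_antisymm (Finset.sum_nonpos hterm) hA) i (Finset.mem_univ i)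
  obtain ⟨h1, h2⟩ := weight_pos hb ω i
  have h3 := hmin (ω + unitVec L i)
  have h4 := hmin (ω - unitVec L i)
  rw [hω] at hz
  by_contra hne
  have : ψ ω₀ < ψ (ω + unitVec L i) := lt_of_le_of_ne h3 (Ne.symm hne)
  nlinarith

theorem cellOp_eq_zero_of_nonneg (hb : ∀ ω, |b ω| < 1 / (2 * (d : ℝ))) {ψ : Torus L → ℝ}
    (h : ∀ ω, 0 ≤ cellOp L b ψ ω) : cellOp L b ψ = 0 := by
  obtain ⟨c, rfl⟩ := eq_const_of_cellOp_nonneg hb h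
  exact cellOp_const b c

/-- According to the sign of `c`, either ψ or -ψ is superharmonic, hence constant. So the constant
that makes a cell problem solvable is unique. -/
theorem eq_zero_of_cellOp_eq_const (hb : ∀ ω, |b ω| < 1 / (2 * (d : ℝ))) {ψ : Torus L → ℝ}
    {c : ℝ} (h : ∀ ω, cellOp L b ψ ω = c) : c = 0 := by
  rcases le_total 0 c with hc | hc
  · have := cellOp_eq_zero_of_nonneg hb (ψ := ψ) (fun ω => by rw [h]; exact hc)
    rw [← h 0, this]; rfl
  · have := cellOp_eq_zero_of_nonneg hb (ψ := -ψ) (fun ω => by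
      rw [map_neg, Pi.neg_apply, h]; linarith)
    rw [map_neg, neg_eq_zero] at this
    rw [← h 0, this]; rfl

/-- The regularised generator `ψ ↦ (I - P) ψ + ∑ ψ`. -/
noncomputable def regOp (L : Fin d → ℕ) [∀ i, NeZero (L i)] (b : Torus L → ℝ) :
    (Torus L → ℝ) →ₗ[ℝ] (Torus L → ℝ) where
  toFun ψ ω := cellOp L b ψ ω + ∑ η, ψ η
  map_add' ψ χ := by
    funext ω
    simp only [map_add, Pi.add_apply, Finset.sum_add_distrib]
    ring
  map_smul' c ψ := by
    funext ω
    simp only [map_smul, Pi.smul_apply, smul_eq_mul, RingHom.id_apply, ← Finset.mul_sum]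
    ring

theorem regOp_apply (b ψ : Torus L → ℝ) (ω : Torus L) :
    regOp L b ψ ω = cellOp L b ψ ω + ∑ η, ψ η := rfl

theorem regOp_injective (hb : ∀ ω, |b ω| < 1 / (2 * (d : ℝ))) :
    Function.Injective (regOp L b) := by
  rw [injective_iff_map_eq_zero]
  intro ψ hψ
  have h1 : ∀ ω, cellOp L b ψ ω = - ∑ η, ψ η := fun ω => by
    have := congrFun hψ ω
    rw [regOp_apply, Pi.zero_apply] at this
    linarith
  have h2 : ∑ η, ψ η = 0 := neg_eq_zero.1 (eq_zero_of_cellOp_eq_const hb h1)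
  obtain ⟨c, rfl⟩ := eq_const_of_cellOp_nonneg hb (ψ := ψ) fun ω => by rw [h1, h2, neg_zero]
  rw [Finset.sum_const, nsmul_eq_mul, mul_eq_zero] at h2
  have : c = 0 := h2.resolve_left (by
    rw [Finset.card_univ]; exact Nat.cast_ne_zero.2 Fintype.card_ne_zero)
  rw [this]; rfl

/-- The rank-one term in `regOp` removes the kernel; on a finite-dimensional space injectivity gives
surjectivity, and the constant is the sum of the solution. -/
theorem exists_cellOp_eq_sub_const (hb : ∀ ω, |b ω| < 1 / (2 * (d : ℝ))) (g : Torus L → ℝ) :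
    ∃ (c : ℝ) (χ : Torus L → ℝ), ∀ ω, cellOp L b χ ω = g ω - c := by
  obtain ⟨χ, hχ⟩ := (LinearMap.injective_iff_surjective.1 (regOp_injective hb)) g
  refine ⟨∑ η, χ η, χ, fun ω => ?_⟩
  rw [← hχ, regOp_apply]
  ring

/-- The cell problem with an antisymmetric right-hand side is solvable. -/
theorem exists_cellOp_eq_of_antisymm (hb : IsAdmissible L b) {g : Torus L → ℝ}
    (hg : ∀ ω, g (reflect L ω) = - g ω) :
    ∃ χ : Torus L → ℝ, (∀ ω, χ (reflect L ω) = - χ ω) ∧ cellOp L b χ = g := by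
  obtain ⟨c, χ, hχ⟩ := exists_cellOp_eq_sub_const hb.abs_lt g
  -- The symmetrised solution has a constant image, which must vanish. It is then itself a constant
  -- `k`, and subtracting `k / 2` makes the solution antisymmetric.
  have hsum : ∀ ω, cellOp L b (χ + fun ω => χ (reflect L ω)) ω = -2 * c := by
    intro ω
    rw [map_add, Pi.add_apply, cellOp_comp_reflect hb, hχ, hχ, hg]
    ring
  have hc : c = 0 := by
    have := eq_zero_of_cellOp_eq_const hb.abs_lt hsum
    linarith
  obtain ⟨k, hk⟩ := eq_const_of_cellOp_nonneg hb.abs_lt (fun ω => by rw [hsum, hc]; simp)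
  refine ⟨χ - fun _ => k / 2, fun ω => ?_, ?_⟩
  · have := congrFun hk ω
    simp only [Pi.add_apply] at this
    simp only [Pi.sub_apply]
    linarith
  · rw [map_sub, cellOp_const, sub_zero]
    funext ω
    rw [hχ, hc, sub_zero]

/-- The data 2b, and `driftOp L b i ψ` for i ≠ 0, are antisymmetric, so they need no correcting
constant. Only the direction e₁ leaves one, and q is that constant plus 1/(2d). -/
theorem exists_isCorrector (hb : IsAdmissible L b) :
    ∃ q ψ χ, IsCorrector L b q ψ χ := by
  obtain ⟨ψ, hψ, hA⟩ := exists_cellOp_eq_of_antisymm hb (g := fun ω => 2 * b ω)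
    (fun ω => by rw [hb.antisymm ω]; ring)
  obtain ⟨c, χ₀, hχ₀⟩ := exists_cellOp_eq_sub_const hb.abs_lt (driftOp L b 0 ψ)
  have hi : ∀ i : Fin d, ∃ χ : Torus L → ℝ, ∀ ω, cellOp L b χ ω =
      driftOp L b i ψ ω + if i = 0 then 1 / (2 * (d : ℝ)) - (c + 1 / (2 * (d : ℝ))) else 0 := by
    intro i
    rcases eq_or_ne i 0 with rfl | hi
    · exact ⟨χ₀, fun ω => by rw [hχ₀, if_pos rfl]; ring⟩
    · obtain ⟨χ, -, hχ⟩ := exists_cellOp_eq_of_antisymm hb (g := driftOp L b i ψ) (fun ω => by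
        simp only [driftOp, if_neg hi, add_zero]
        rw [← reflect_add_unitVec _ hi, ← reflect_sub_unitVec _ hi, hψ, hψ]
        ring)
      exact ⟨χ, fun ω => by rw [hχ, if_neg hi, add_zero]⟩
  choose χ hχ using hi
  exact ⟨_, ψ, χ, hψ, fun ω => by rw [hA], hχ⟩

/-- If q ≤ 0, the energy identity gives a superharmonic function, so the energy vanishes and ψ drops
by 1 at each step along e₁. This is impossible on a periodic lattice, as summing over the torus
shows. -/
theorem IsCorrector.pos (hb : IsAdmissible L b) {q : ℝ} {ψ : Torus L → ℝ}
    {χ : Fin d → Torus L → ℝ} (h : IsCorrector L b q ψ χ) : 0 < q := by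
  by_contra! hq
  have hterm : ∀ ω, ∀ i ∈ (Finset.univ : Finset (Fin d)),
      0 ≤ ((1 / (2 * (d : ℝ)) + if i = 0 then b ω else 0)
        * ((if i = 0 then 1 else 0) + ψ (ω + unitVec L i) - ψ ω) ^ 2
      + (1 / (2 * (d : ℝ)) - if i = 0 then b ω else 0)
        * ((if i = 0 then -1 else 0) + ψ (ω - unitVec L i) - ψ ω) ^ 2) := fun ω i _ => by
    obtain ⟨h1, h2⟩ := weight_pos hb.abs_lt ω i
    positivity
  have hE : ∀ ω, 0 ≤ energyDensity L b ψ ω := fun ω =>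
    mul_nonneg (by norm_num) (Finset.sum_nonneg (hterm ω))
  have hz := cellOp_eq_zero_of_nonneg hb.abs_lt (fun ω => by
    rw [h.cellOp_sub_half_sq]; linarith [hE ω])
  have hstep : ∀ ω, 1 + ψ (ω + unitVec L 0) - ψ ω = 0 := by
    intro ω
    have h0 := h.cellOp_sub_half_sq ω
    rw [hz, Pi.zero_apply] at h0
    have h1 : energyDensity L b ψ ω = 0 := le_antisymm (by linarith) (hE ω)
    rw [energyDensity, mul_eq_zero] at h1
    have h2 := (Finset.sum_eq_zero_iff_of_nonneg (hterm ω)).1 (h1.resolve_left (by norm_num)) 0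
      (Finset.mem_univ _)
    obtain ⟨h3, h4⟩ := weight_pos hb.abs_lt ω 0
    simp only [if_true] at h2 h3 h4
    have h5 := mul_nonneg h3.le (sq_nonneg (1 + ψ (ω + unitVec L 0) - ψ ω))
    have h6 := mul_nonneg h4.le (sq_nonneg (-1 + ψ (ω - unitVec L 0) - ψ ω))
    have h7 := (mul_eq_zero.1 (le_antisymm (by linarith) h5)).resolve_left h3.ne'
    exact pow_eq_zero_iff (two_ne_zero) |>.1 h7
  have hsum : ∑ ω : Torus L, (1 + ψ (ω + unitVec L 0) - ψ ω) = Fintype.card (Torus L) := by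
    rw [Finset.sum_sub_distrib, Finset.sum_add_distrib,
      Fintype.sum_equiv (Equiv.addRight (unitVec L 0)) (fun ω => ψ (ω + unitVec L 0)) ψ
        (fun _ => rfl)]
    simp
  rw [Finset.sum_eq_zero fun ω _ => hstep ω] at hsum
  exact Fintype.card_ne_zero (Nat.cast_eq_zero.1 hsum.symm)

end Cell

/-! ### The difference equation on the lattice: maximum principle, existence, uniqueness -/

section Lattice

/-- A uniformly contracting map of functions has a bounded fixed point. -/
theorem exists_bounded_fixedPoint {X : Type*} (K : (X → ℝ) → X → ℝ) {θ : ℝ} (hθ₀ : 0 ≤ θ)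
    (hθ : θ < 1) (hK₀ : ∃ C, ∀ x, |K 0 x| ≤ C)
    (hK : ∀ u v D, (∀ x, |u x - v x| ≤ D) → ∀ x, |K u x - K v x| ≤ θ * D) :
    ∃ u, (∃ C, ∀ x, |u x| ≤ C) ∧ K u = u := by
  -- With the discrete topology every bounded function is bounded continuous, so Banach's theorem
  -- applies in a complete space.
  let _ : TopologicalSpace X := ⊥
  have : DiscreteTopology X := ⟨rfl⟩
  obtain ⟨C₀, hC₀⟩ := hK₀
  have hbdd : ∀ u : BoundedContinuousFunction X ℝ, ∀ x, ‖K u x‖ ≤ θ * ‖u‖ + C₀ := by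
    intro u x
    have h1 := hK u 0 ‖u‖ (fun y => by simpa using u.norm_coe_le_norm y) x
    have h2 := hC₀ x
    rw [Real.norm_eq_abs]
    calc |K u x| = |(K u x - K 0 x) + K 0 x| := by ring_nf
      _ ≤ |K u x - K 0 x| + |K 0 x| := abs_add_le _ _
      _ ≤ _ := add_le_add h1 h2
  let Φ : BoundedContinuousFunction X ℝ → BoundedContinuousFunction X ℝ := fun u =>
    BoundedContinuousFunction.ofNormedAddCommGroupDiscrete (K u) _ (hbdd u)
  have hΦ : ContractingWith ⟨θ, hθ₀⟩ Φ := by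
    refine ⟨by exact_mod_cast hθ, LipschitzWith.of_dist_le_mul fun u v => ?_⟩
    rw [BoundedContinuousFunction.dist_le (by positivity)]
    intro x
    rw [Real.dist_eq]
    exact hK u v (dist u v) (fun y => by
      rw [← Real.dist_eq]; exact BoundedContinuousFunction.dist_coe_le_dist y) x
  refine ⟨hΦ.fixedPoint, ⟨‖hΦ.fixedPoint‖, fun x => ?_⟩, ?_⟩
  · exact (hΦ.fixedPoint).norm_coe_le_norm x
  · have := hΦ.fixedPoint_isFixedPt
    exact congrArg (fun u : BoundedContinuousFunction X ℝ => (u : X → ℝ)) this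

variable {d : ℕ} [NeZero d] {L : Fin d → ℕ}

/-- The average of the values `P i` and `M i` at the neighbours in the directions `± e_i`, for the
one-step law with drift `β`. -/
noncomputable def stepAvg (β : ℝ) (P M : Fin d → ℝ) : ℝ :=
  ∑ i : Fin d, 1 / (2 * (d : ℝ)) * (P i + M i) + β * (P 0 - M 0)

theorem stepAvg_eq_sum (β : ℝ) (P M : Fin d → ℝ) : stepAvg β P M = ∑ i : Fin d,
    ((1 / (2 * (d : ℝ)) + if i = 0 then β else 0) * P i
      + (1 / (2 * (d : ℝ)) - if i = 0 then β else 0) * M i) := by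
  have h : β * (P 0 - M 0) = ∑ i : Fin d, if i = 0 then β * (P i - M i) else 0 := by
    simp
  rw [stepAvg, h, ← Finset.sum_add_distrib]
  refine Finset.sum_congr rfl fun i _ => ?_
  split_ifs <;> ring

theorem stepAvg_sub (β : ℝ) (P M P' M' : Fin d → ℝ) :
    stepAvg β (fun i => P i - P' i) (fun i => M i - M' i)
      = stepAvg β P M - stepAvg β P' M' := by
  rw [stepAvg_eq_sum, stepAvg_eq_sum, stepAvg_eq_sum, ← Finset.sum_sub_distrib]
  exact Finset.sum_congr rfl fun i _ => by ring

theorem abs_stepAvg_le {β : ℝ} (hβ : |β| < 1 / (2 * (d : ℝ))) {P M : Fin d → ℝ} {D : ℝ}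
    (hP : ∀ i, |P i| ≤ D) (hM : ∀ i, |M i| ≤ D) : |stepAvg β P M| ≤ D := by
  rw [stepAvg_eq_sum, ← sum_inv_two_mul_dim (d := d) D]
  refine (Finset.abs_sum_le_sum_abs _ _).trans (Finset.sum_le_sum fun i _ => ?_)
  have hd : (0 : ℝ) < 1 / (2 * (d : ℝ)) := lt_of_le_of_lt (abs_nonneg _) hβ
  obtain ⟨hp, hm⟩ : 0 ≤ 1 / (2 * (d : ℝ)) + (if i = 0 then β else 0) ∧
      0 ≤ 1 / (2 * (d : ℝ)) - (if i = 0 then β else 0) := by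
    have := abs_lt.1 hβ
    split_ifs <;> constructor <;> linarith
  refine (abs_add_le _ _).trans ?_
  rw [abs_mul, abs_mul, abs_of_nonneg hp, abs_of_nonneg hm]
  have h3 := mul_le_mul_of_nonneg_left (hP i) hp
  have h4 := mul_le_mul_of_nonneg_left (hM i) hm
  linarith

/-- The transition operator of the random walk on `ℤ^d` with drift `b`. -/
noncomputable def walkOp (L : Fin d → ℕ) (b : Torus L → ℝ) (U : (Fin d → ℤ) → Torus L → ℝ)
    (n : Fin d → ℤ) (ω : Torus L) : ℝ :=
  stepAvg (b (translate L n ω)) (fun i => U (n + Pi.single i 1) ω)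
    (fun i => U (n - Pi.single i 1) ω)

theorem walkOp_sub (b : Torus L → ℝ) (U V : (Fin d → ℤ) → Torus L → ℝ) (n : Fin d → ℤ)
    (ω : Torus L) : walkOp L b (U - V) n ω = walkOp L b U n ω - walkOp L b V n ω :=
  stepAvg_sub _ _ _ _ _

theorem abs_walkOp_le {b : Torus L → ℝ} (hb : ∀ ω, |b ω| < 1 / (2 * (d : ℝ)))
    {U : (Fin d → ℤ) → Torus L → ℝ} {D : ℝ} (hU : ∀ n ω, |U n ω| ≤ D) (n : Fin d → ℤ)
    (ω : Torus L) : |walkOp L b U n ω| ≤ D :=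
  abs_stepAvg_le (hb _) (fun _ => hU _ _) (fun _ => hU _ _)

/-- The maximum principle for the difference equation. -/
theorem abs_le_of_abs_equation_le {b : Torus L → ℝ} (hb : ∀ ω, |b ω| < 1 / (2 * (d : ℝ)))
    {ε : ℝ} (hε : 0 < ε) {W : (Fin d → ℤ) → Torus L → ℝ} (hW : ∃ C, ∀ n ω, |W n ω| ≤ C)
    {M : ℝ} (hM : ∀ n ω, |W n ω - walkOp L b W n ω + ε ^ 2 * W n ω| ≤ ε ^ 2 * M)
    (n : Fin d → ℤ) (ω : Torus L) : |W n ω| ≤ M := by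
  obtain ⟨C, hC⟩ := hW
  have hbdd : BddAbove (Set.range fun p : (Fin d → ℤ) × Torus L => |W p.1 p.2|) :=
    ⟨C, by rintro _ ⟨p, rfl⟩; exact hC _ _⟩
  set S := ⨆ p : (Fin d → ℤ) × Torus L, |W p.1 p.2| with hS
  have hle : ∀ n ω, |W n ω| ≤ S := fun n ω => le_ciSup hbdd (n, ω)
  have hpos : 0 < ε ^ 2 := by positivity
  -- The supremum need not be attained on the infinite lattice, so the equation is solved for (1 +
  -- ε²)W at each point and the supremum taken afterwards.
  have hstep : ∀ p : (Fin d → ℤ) × Torus L, |W p.1 p.2| ≤ (S + ε ^ 2 * M) / (1 + ε ^ 2) := by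
    intro p
    rw [le_div_iff₀ (by positivity)]
    have h1 := abs_walkOp_le hb hle p.1 p.2
    have h2 := hM p.1 p.2
    calc |W p.1 p.2| * (1 + ε ^ 2) = |W p.1 p.2 * (1 + ε ^ 2)| := by
          rw [abs_mul, abs_of_pos (a := 1 + ε ^ 2) (by positivity)]
      _ = |walkOp L b W p.1 p.2
            + (W p.1 p.2 - walkOp L b W p.1 p.2 + ε ^ 2 * W p.1 p.2)| := by ring_nf
      _ ≤ _ := (abs_add_le _ _).trans (add_le_add h1 h2)
  have : Nonempty ((Fin d → ℤ) × Torus L) := ⟨(n, ω)⟩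
  have hSle := ciSup_le hstep
  rw [← hS, le_div_iff₀ (by positivity)] at hSle
  have : S ≤ M := by
    by_contra! h
    nlinarith
  exact (hle n ω).trans this

theorem isDiscreteSolution_iff {b : Torus L → ℝ} {f : EuclideanSpace ℝ (Fin d) → ℝ} {ε : ℝ}
    {U : (Fin d → ℤ) → Torus L → ℝ} : IsDiscreteSolution L b f ε U ↔
      (∃ C : ℝ, ∀ n ω, |U n ω| ≤ C) ∧
      ∀ n ω, U n ω - walkOp L b U n ω + ε ^ 2 * U n ω = ε ^ 2 * f (latticePoint ε n) := by
  constructor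
  · intro h
    refine ⟨h.bounded, fun n ω => ?_⟩
    rw [← h.equation n ω, walkOp, stepAvg]
    ring
  · intro h
    refine ⟨h.1, fun n ω => ?_⟩
    rw [← h.2 n ω, walkOp, stepAvg]
    ring

theorem IsDiscreteSolution.unique {b : Torus L → ℝ} (hb : ∀ ω, |b ω| < 1 / (2 * (d : ℝ)))
    {f : EuclideanSpace ℝ (Fin d) → ℝ} {ε : ℝ} (hε : 0 < ε)
    {U V : (Fin d → ℤ) → Torus L → ℝ} (hU : IsDiscreteSolution L b f ε U)
    (hV : IsDiscreteSolution L b f ε V) : U = V := by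
  rw [isDiscreteSolution_iff] at hU hV
  obtain ⟨⟨C, hC⟩, hU⟩ := hU
  obtain ⟨⟨C', hC'⟩, hV⟩ := hV
  have hW : ∃ D, ∀ n ω, |(U - V) n ω| ≤ D := ⟨C + C', fun n ω =>
    (abs_sub _ _).trans (add_le_add (hC n ω) (hC' n ω))⟩
  funext n ω
  have := abs_le_of_abs_equation_le hb hε hW (M := 0) (fun n ω => by
    have h : (U - V) n ω - walkOp L b (U - V) n ω + ε ^ 2 * (U - V) n ω
        = (U n ω - walkOp L b U n ω + ε ^ 2 * U n ω)
        - (V n ω - walkOp L b V n ω + ε ^ 2 * V n ω) := by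
      rw [walkOp_sub]; simp only [Pi.sub_apply]; ring
    rw [h, hU, hV]; simp) n ω
  have h0 := abs_nonpos_iff.1 this
  simp only [Pi.sub_apply] at h0
  linarith

/-- The equation reads U = (1 + ε²)⁻¹(PU + ε²f), and P does not increase the supremum norm, so the
right-hand side is a contraction. -/
theorem exists_isDiscreteSolution {b : Torus L → ℝ} (hb : ∀ ω, |b ω| < 1 / (2 * (d : ℝ)))
    {f : EuclideanSpace ℝ (Fin d) → ℝ} (hf : ∃ C, ∀ x, |f x| ≤ C) {ε : ℝ} (hε : 0 < ε) :
    ∃ U, IsDiscreteSolution L b f ε U := by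
  obtain ⟨C, hC⟩ := hf
  have hpos : 0 < ε ^ 2 := by positivity
  obtain ⟨u, ⟨C', hC'⟩, hu⟩ := exists_bounded_fixedPoint
    (fun (u : (Fin d → ℤ) × Torus L → ℝ) p =>
      (1 + ε ^ 2)⁻¹ * (walkOp L b (fun n ω => u (n, ω)) p.1 p.2
        + ε ^ 2 * f (latticePoint ε p.1)))
    (θ := (1 + ε ^ 2)⁻¹) (by positivity) (inv_lt_one_of_one_lt₀ (by linarith))
    ⟨(1 + ε ^ 2)⁻¹ * (0 + ε ^ 2 * C), fun p => by
      rw [abs_mul, abs_of_pos (a := (1 + ε ^ 2)⁻¹) (by positivity)]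
      refine mul_le_mul_of_nonneg_left ((abs_add_le _ _).trans (add_le_add ?_ ?_))
        (by positivity)
      · exact abs_walkOp_le hb (fun n ω => by simp) _ _
      · rw [abs_mul, abs_of_pos hpos]
        exact mul_le_mul_of_nonneg_left (hC _) hpos.le⟩
    (fun u v D h p => by
      have hdiff := abs_walkOp_le hb (U := (fun n ω => u (n, ω)) - fun n ω => v (n, ω))
        (fun n ω => h (n, ω)) p.1 p.2
      rw [walkOp_sub] at hdiff
      rw [← mul_sub, add_sub_add_right_eq_sub, abs_mul,
        abs_of_pos (a := (1 + ε ^ 2)⁻¹) (by positivity)]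
      exact mul_le_mul_of_nonneg_left hdiff (by positivity))
  refine ⟨fun n ω => u (n, ω), isDiscreteSolution_iff.2 ⟨⟨C', fun n ω => hC' (n, ω)⟩, ?_⟩⟩
  intro n ω
  have h := congrFun hu (n, ω)
  simp only at h
  rw [inv_mul_eq_iff_eq_mul₀ (by positivity)] at h
  linarith

end Lattice

/-! ### The constant-coefficient elliptic equation in Schwartz space -/

section Elliptic

open SchwartzMap LineDeriv FourierTransform Real

variable {d : ℕ}

/-- The anisotropic scaling `ξ ↦ (c_j ξ_j)_j`. -/
noncomputable def diagScale (c : Fin d → ℝ) :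
    EuclideanSpace ℝ (Fin d) →L[ℝ] EuclideanSpace ℝ (Fin d) :=
  ∑ j, ((c j) • (EuclideanSpace.proj j : EuclideanSpace ℝ (Fin d) →L[ℝ] ℝ)).smulRight
    (EuclideanSpace.single j 1)

theorem norm_diagScale_sq (c : Fin d → ℝ) (ξ : EuclideanSpace ℝ (Fin d)) :
    ‖diagScale c ξ‖ ^ 2 = ∑ j, c j ^ 2 * ξ j ^ 2 := by
  rw [EuclideanSpace.norm_sq_eq]
  refine Finset.sum_congr rfl fun j _ => ?_
  simp [diagScale, mul_pow, Pi.single_apply]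

/-- Schwartz solutions of `u - ∑ c_j ∂_j² u = f` for nonnegative `c`. -/
theorem exists_schwartz_solution_complex {c : Fin d → ℝ} (hc : ∀ j, 0 ≤ c j)
    (f : 𝓢(EuclideanSpace ℝ (Fin d), ℂ)) :
    ∃ u : 𝓢(EuclideanSpace ℝ (Fin d), ℂ),
      u - ∑ j, (c j) • ∂_{EuclideanSpace.single j (1 : ℝ)} (∂_{EuclideanSpace.single j (1 : ℝ)} u)
        = f := by
  let E := EuclideanSpace ℝ (Fin d)
  let s : E → ℝ := fun ξ => 1 + ∑ j, (c j * (2 * π) ^ 2) *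
    (inner ℝ ξ (EuclideanSpace.single j (1 : ℝ)) * inner ℝ ξ (EuclideanSpace.single j (1 : ℝ)))
  -- `m` is the reciprocal of the symbol `s`. Written as a power of 1 + ‖x‖² after a linear map, it
  -- visibly has temperate growth.
  let m : E → ℝ := (fun x : E => (1 + ‖x‖ ^ 2) ^ (-1 : ℝ)) ∘ diagScale (fun j => 2 * π * √(c j))
  have hm : m.HasTemperateGrowth := by
    refine (Function.hasTemperateGrowth_one_add_norm_sq_rpow E (-1)).comp ?_
    exact (diagScale _).hasTemperateGrowth
  have hs : s.HasTemperateGrowth := by fun_prop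
  have hsm : s * m = fun _ => 1 := by
    funext ξ
    have h1 : s ξ = 1 + ‖diagScale (fun j => 2 * π * √(c j)) ξ‖ ^ 2 := by
      rw [norm_diagScale_sq]
      simp only [s]
      congr 1
      refine Finset.sum_congr rfl fun j _ => ?_
      rw [mul_pow (2 * π) (√(c j)), Real.sq_sqrt (hc j), EuclideanSpace.inner_single_right]
      simp
      ring
    have h2 : 0 < 1 + ‖diagScale (fun j => 2 * π * √(c j)) ξ‖ ^ 2 := by positivity
    simp only [Pi.mul_apply, h1, m, Function.comp]
    rw [Real.rpow_neg_one, mul_inv_cancel₀ h2.ne']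
  refine ⟨fourierMultiplierCLM ℂ m f, ?_⟩
  set u := fourierMultiplierCLM ℂ m f with hu
  have hf : fourierMultiplierCLM ℂ s u = f := by
    rw [hu, fourierMultiplierCLM_fourierMultiplierCLM_apply hs hm, hsm,
      fourierMultiplierCLM_const]
    simp
  have hder : ∀ j, ∂_{EuclideanSpace.single j (1 : ℝ)} (∂_{EuclideanSpace.single j (1 : ℝ)} u)
      = (-(2 * π) ^ 2 : ℝ) • fourierMultiplierCLM ℂ (fun ξ : E =>
        inner ℝ ξ (EuclideanSpace.single j (1 : ℝ)) * inner ℝ ξ (EuclideanSpace.single j (1 : ℝ)))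
        u := by
    intro j
    rw [lineDeriv_eq_fourierMultiplierCLM (EuclideanSpace.single j (1 : ℝ)) u, lineDerivOp_smul,
      lineDeriv_eq_fourierMultiplierCLM, smul_smul,
      fourierMultiplierCLM_fourierMultiplierCLM_apply (by fun_prop) (by fun_prop)]
    have : (2 * (π : ℂ) * Complex.I * (2 * π * Complex.I)) = ((-(2 * π) ^ 2 : ℝ) : ℂ) := by
      push_cast
      linear_combination (4 * (π : ℂ) ^ 2) * Complex.I_sq
    rw [this]
    ext x
    simp only [Pi.mul_def, Complex.coe_smul]
    rfl
  have hsum : fourierMultiplierCLM ℂ s u = u + ∑ j, (c j * (2 * π) ^ 2) •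
      fourierMultiplierCLM ℂ (fun ξ : E =>
        inner ℝ ξ (EuclideanSpace.single j (1 : ℝ)) * inner ℝ ξ (EuclideanSpace.single j (1 : ℝ)))
        u := by
    have h1 : s = (fun _ => (1 : ℝ)) + fun ξ : E => ∑ j, (c j * (2 * π) ^ 2) *
      (inner ℝ ξ (EuclideanSpace.single j (1 : ℝ)) * inner ℝ ξ (EuclideanSpace.single j (1 : ℝ))) :=
      rfl
    rw [fourierMultiplierCLM_apply, h1, smulLeftCLM_add (by fun_prop) (by fun_prop),
      _root_.add_apply, fourierInv_add]
    rw [← fourierMultiplierCLM_apply, ← fourierMultiplierCLM_apply, fourierMultiplierCLM_const,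
      fourierMultiplierCLM_sum ℂ (fun j _ => by fun_prop)]
    rw [_root_.sum_apply]
    congr 1
    · simp
    · refine Finset.sum_congr rfl fun j _ => ?_
      have := fourierMultiplierCLM_smul (F := ℂ) (g := fun ξ : E =>
        inner ℝ ξ (EuclideanSpace.single j (1 : ℝ)) * inner ℝ ξ (EuclideanSpace.single j (1 : ℝ)))
        (by fun_prop) (c j * (2 * π) ^ 2)
      rw [← _root_.smul_apply, ← this]
      rfl
  rw [← hf, hsum, sub_eq_add_neg, ← Finset.sum_neg_distrib]
  congr 1
  refine Finset.sum_congr rfl fun j _ => ?_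
  rw [hder, smul_smul, ← neg_smul]
  congr 1
  ring

theorem exists_schwartz_solution {c : Fin d → ℝ} (hc : ∀ j, 0 ≤ c j)
    (f : 𝓢(EuclideanSpace ℝ (Fin d), ℝ)) :
    ∃ u : 𝓢(EuclideanSpace ℝ (Fin d), ℝ), ∀ x,
      u x - ∑ j, c j * ∂_{EuclideanSpace.single j (1 : ℝ)} (∂_{EuclideanSpace.single j (1 : ℝ)} u) x
        = f x := by
  obtain ⟨v, hv⟩ := exists_schwartz_solution_complex hc (f.postcompCLM Complex.ofRealCLM)
  have hcomm : ∀ (m : EuclideanSpace ℝ (Fin d)) (w : 𝓢(EuclideanSpace ℝ (Fin d), ℂ)),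
      ∂_{m} (w.postcompCLM Complex.reCLM) = (∂_{m} w).postcompCLM Complex.reCLM := by
    intro m w
    ext x
    rw [postcompCLM_apply, lineDerivOp_apply_eq_fderiv, lineDerivOp_apply_eq_fderiv]
    have : (w.postcompCLM Complex.reCLM : EuclideanSpace ℝ (Fin d) → ℝ)
        = Complex.reCLM ∘ w := by
      funext y; exact postcompCLM_apply _ _ _
    rw [this, (Complex.reCLM.hasFDerivAt.comp x (w.hasFDerivAt x)).fderiv]
    rfl
  refine ⟨v.postcompCLM Complex.reCLM, fun x => ?_⟩
  have h := congrArg (fun w : 𝓢(EuclideanSpace ℝ (Fin d), ℂ) => (w x).re) hv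
  simp only [hcomm, postcompCLM_apply]
  simpa using h

end Elliptic

/-! ### Taylor bounds, the homogenized equation and uniqueness of the coefficient -/

section Homogenized

open SchwartzMap LineDeriv

theorem hasDerivAt_along_line {E : Type*} [NormedAddCommGroup E] [NormedSpace ℝ E] {F : E → ℝ}
    (hF : Differentiable ℝ F) (x v : E) (t : ℝ) :
    HasDerivAt (fun s : ℝ => F (x + s • v)) (lineDeriv ℝ F (x + t • v) v) t := by
  rw [(hF _).lineDeriv_eq_fderiv]
  have h1 : HasDerivAt (fun s : ℝ => x + s • v) v t := by
    simpa using ((hasDerivAt_id t).smul_const v).const_add x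
  exact (hF (x + t • v)).hasFDerivAt.comp_hasDerivAt t h1

/-- The mean value inequality on the ball of radius |t|, which treats both signs of t at once. Each
use raises the order of the Taylor bounds below by one, with non-optimal constants. -/
theorem abs_sub_le_of_abs_deriv_le {g g' : ℝ → ℝ} (hg : ∀ s, HasDerivAt g (g' s) s) {C t : ℝ}
    (h : ∀ s, |s| ≤ |t| → |g' s| ≤ C) : |g t - g 0| ≤ C * |t| := by
  have := (convex_closedBall (0 : ℝ) |t|).norm_image_sub_le_of_norm_hasDerivWithin_le
    (f := g) (f' := g') (C := C) (x := 0) (y := t) (fun s _ => (hg s).hasDerivWithinAt)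
    (fun s hs => h s (by simpa using hs)) (by simp) (by simp)
  simpa using this

variable {d : ℕ}

section Taylor

theorem schwartz_exists_abs_le {E : Type*} [NormedAddCommGroup E] [NormedSpace ℝ E]
    (w : 𝓢(E, ℝ)) : ∃ C, 0 ≤ C ∧ ∀ x, |w x| ≤ C :=
  ⟨_, apply_nonneg _ _, fun x => w.norm_le_seminorm ℝ x⟩

variable {E : Type*} [NormedAddCommGroup E] [NormedSpace ℝ E]

theorem schwartz_hasDerivAt_along_line (w : 𝓢(E, ℝ)) (x v : E) (t : ℝ) :
    HasDerivAt (fun s : ℝ => w (x + s • v)) (∂_{v} w (x + t • v)) t := by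
  rw [lineDerivOp_apply]
  exact hasDerivAt_along_line w.differentiable x v t

theorem schwartz_exists_abs_sub_le (w : 𝓢(E, ℝ)) (v : E) :
    ∃ C, 0 ≤ C ∧ ∀ x (t : ℝ), |w (x + t • v) - w x| ≤ C * |t| := by
  obtain ⟨C, hC₀, hC⟩ := schwartz_exists_abs_le (∂_{v} w)
  refine ⟨C, hC₀, fun x t => ?_⟩
  have := abs_sub_le_of_abs_deriv_le (t := t) (C := C)
    (fun s => schwartz_hasDerivAt_along_line w x v s) (fun s _ => hC _)
  simpa using this

theorem schwartz_exists_abs_sub_le_sq (w : 𝓢(E, ℝ)) (v : E) :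
    ∃ C, 0 ≤ C ∧ ∀ x (t : ℝ), |w (x + t • v) - w x - t * ∂_{v} w x| ≤ C * |t| ^ 2 := by
  obtain ⟨C, hC₀, hC⟩ := schwartz_exists_abs_sub_le (∂_{v} w) v
  refine ⟨C, hC₀, fun x t => ?_⟩
  have := abs_sub_le_of_abs_deriv_le (t := t) (C := C * |t|)
    (g := fun s => w (x + s • v) - s * ∂_{v} w x)
    (fun s => (schwartz_hasDerivAt_along_line w x v s).sub
      ((hasDerivAt_id s).mul_const (∂_{v} w x)))
    (fun s hs => by
      rw [one_mul]
      exact (hC x s).trans (mul_le_mul_of_nonneg_left hs hC₀))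
  simp only [zero_smul, add_zero, zero_mul, sub_zero] at this
  calc _ = |w (x + t • v) - t * ∂_{v} w x - w x| := by ring_nf
    _ ≤ _ := this
    _ = _ := by ring

theorem schwartz_exists_abs_sub_le_cube (w : 𝓢(E, ℝ)) (v : E) :
    ∃ C, 0 ≤ C ∧ ∀ x (t : ℝ),
      |w (x + t • v) - w x - t * ∂_{v} w x - t ^ 2 / 2 * ∂_{v} (∂_{v} w) x| ≤ C * |t| ^ 3 := by
  obtain ⟨C, hC₀, hC⟩ := schwartz_exists_abs_sub_le_sq (∂_{v} w) v
  refine ⟨C, hC₀, fun x t => ?_⟩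
  have := abs_sub_le_of_abs_deriv_le (t := t) (C := C * |t| ^ 2)
    (g := fun s => w (x + s • v) - s * ∂_{v} w x - s ^ 2 / 2 * ∂_{v} (∂_{v} w) x)
    (fun s => ((schwartz_hasDerivAt_along_line w x v s).sub
      ((hasDerivAt_id s).mul_const (∂_{v} w x))).sub
      ((((hasDerivAt_id s).pow 2).div_const 2).mul_const (∂_{v} (∂_{v} w) x)))
    (fun s hs => by
      have h1 : ∂_{v} w (x + s • v) - 1 * ∂_{v} w x
          - ((2 : ℕ) : ℝ) * id s ^ (2 - 1) * 1 / 2 * ∂_{v} (∂_{v} w) x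
          = ∂_{v} w (x + s • v) - ∂_{v} w x - s * ∂_{v} (∂_{v} w) x := by
        simp
      rw [h1]
      exact (hC x s).trans
        (mul_le_mul_of_nonneg_left (pow_le_pow_left₀ (abs_nonneg _) hs 2) hC₀))
  simp only [zero_smul, add_zero, zero_mul, sub_zero, ne_eq, OfNat.ofNat_ne_zero,
    not_false_eq_true, zero_pow, zero_div] at this
  calc _ = |w (x + t • v) - t * ∂_{v} w x - t ^ 2 / 2 * ∂_{v} (∂_{v} w) x - w x| := by ring_nf
    _ ≤ _ := this
    _ = _ := by ring

end Taylor

theorem schwartz_secondPartial_eq (u : 𝓢(EuclideanSpace ℝ (Fin d), ℝ)) (j : Fin d)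
    (x : EuclideanSpace ℝ (Fin d)) : secondPartial j u x =
      ∂_{EuclideanSpace.single j (1 : ℝ)} (∂_{EuclideanSpace.single j (1 : ℝ)} u) x := by
  rw [lineDerivOp_apply, secondPartial]
  congr 1
  funext y
  rw [lineDerivOp_apply]

variable [NeZero d]

/-- The homogenized equation has a Schwartz solution. -/
theorem exists_isHomogenizedSolution {q : ℝ} (hq : 0 < q) {f : EuclideanSpace ℝ (Fin d) → ℝ}
    (hf : ContDiff ℝ ((⊤ : ℕ∞) : WithTop ℕ∞) f) (hfc : HasCompactSupport f) :
    ∃ u : 𝓢(EuclideanSpace ℝ (Fin d), ℝ), IsHomogenizedSolution q f u := by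
  obtain ⟨u, hu⟩ := exists_schwartz_solution
    (c := fun j : Fin d => if j = 0 then q else 1 / (2 * (d : ℝ)))
    (fun j => by
      split_ifs
      · exact hq.le
      · positivity) (hfc.toSchwartzMap hf)
  refine ⟨u, ?_, ?_, ?_⟩
  · exact u.smooth 2
  · obtain ⟨C, -, hC⟩ := schwartz_exists_abs_le u
    exact ⟨C, hC⟩
  · intro x
    have h := hu x
    rw [← Finset.add_sum_erase _ _ (Finset.mem_univ (0 : Fin d)), if_pos rfl,
      Finset.sum_congr rfl fun j hj => by rw [if_neg (Finset.ne_of_mem_erase hj)]] at h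
    simp only [schwartz_secondPartial_eq]
    have h2 : hfc.toSchwartzMap hf x = f x := rfl
    rw [← h2, ← h]
    ring

theorem lineDeriv_add_of_invariant {E : Type*} [NormedAddCommGroup E] [NormedSpace ℝ E]
    {u : E → ℝ} {a : E} (h : ∀ y, u (y + a) = u y) (x v : E) :
    lineDeriv ℝ u (x + a) v = lineDeriv ℝ u x v := by
  have : (fun t : ℝ => u (x + a + t • v)) = fun t : ℝ => u (x + t • v) := by
    funext t
    rw [add_right_comm, h]
  rw [lineDeriv, lineDeriv, this]

/-- A bounded function with vanishing second derivative is constant. -/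
theorem eq_of_bounded_of_second_deriv_zero {g g' : ℝ → ℝ} (hg : ∀ s, HasDerivAt g (g' s) s)
    (hg' : ∀ s, HasDerivAt g' 0 s) {C : ℝ} (hC : ∀ s, |g s| ≤ C) (t : ℝ) : g t = g 0 := by
  have h1 : ∀ s, g' s = g' 0 := fun s => by
    have := abs_sub_le_of_abs_deriv_le (t := s) (C := 0) hg' (fun _ _ => by simp)
    rw [zero_mul] at this
    exact sub_eq_zero.1 (abs_nonpos_iff.1 this)
  have h2 : ∀ s, g s - s * g' 0 = g 0 := fun s => by
    have := abs_sub_le_of_abs_deriv_le (t := s) (C := 0) (g := fun s => g s - s * g' 0)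
      (fun s => (hg s).sub ((hasDerivAt_id s).mul_const (g' 0)))
      (fun r _ => by rw [h1 r]; simp)
    rw [zero_mul, zero_mul] at this
    have := sub_eq_zero.1 (abs_nonpos_iff.1 this)
    simpa using this
  have h3 : g' 0 = 0 := by
    by_contra hne
    have h4 := h2 ((2 * C + 1) / g' 0)
    rw [div_mul_cancel₀ _ hne] at h4
    have h5 := abs_le.1 (hC ((2 * C + 1) / g' 0))
    have h6 := abs_le.1 (hC 0)
    linarith
  have := h2 t
  rw [h3] at this
  linarith

/-- One bounded function cannot solve the homogenized equation for two different coefficients,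
unless the right-hand side is trivial. -/
theorem IsHomogenizedSolution.coefficient_unique {q q' : ℝ} {f u : EuclideanSpace ℝ (Fin d) → ℝ}
    (hfc : HasCompactSupport f) (hf0 : f 0 ≠ 0) (h : IsHomogenizedSolution q f u)
    (h' : IsHomogenizedSolution q' f u) : q = q' := by
  by_contra hne
  set e : EuclideanSpace ℝ (Fin d) := EuclideanSpace.single 0 1 with he
  have hsec : ∀ x, secondPartial 0 u x = 0 := by
    intro x
    have h1 := h.equation x
    have h2 := h'.equation x
    have h3 : (q - q') * secondPartial 0 u x = 0 := by linarith
    exact (mul_eq_zero.1 h3).resolve_left (sub_ne_zero.2 hne)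
  have hu : Differentiable ℝ u := h.contDiff.differentiable (by norm_num)
  have hu' : Differentiable ℝ (fun y => lineDeriv ℝ u y e) := by
    have : (fun y => lineDeriv ℝ u y e) = fun y => fderiv ℝ u y e := by
      funext y; exact (hu y).lineDeriv_eq_fderiv
    rw [this]
    have h1 : ContDiff ℝ 1 (fderiv ℝ u) := h.contDiff.fderiv_right (by norm_num)
    exact (h1.differentiable (by norm_num)).clm_apply (differentiable_const e)
  obtain ⟨C, hC⟩ := h.bounded
  have hinv : ∀ (t : ℝ) x, u (x + t • e) = u x := by
    intro t x
    have := eq_of_bounded_of_second_deriv_zero (g := fun s : ℝ => u (x + s • e))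
      (fun s => hasDerivAt_along_line hu x e s)
      (fun s => by
        have h1 := hasDerivAt_along_line hu' x e s
        have h2 := hsec (x + s • e)
        rw [secondPartial, ← he] at h2
        rwa [h2] at h1) (fun s => hC _) t
    simpa using this
  have hpart : ∀ (t : ℝ) x j, secondPartial j u (x + t • e) = secondPartial j u x := by
    intro t x j
    exact lineDeriv_add_of_invariant (fun y => lineDeriv_add_of_invariant (hinv t) y _) x _
  -- All terms on the left of the equation are invariant along e₁, hence so is `f`; a nonzero value
  -- at 0 would then persist along an unbounded line.
  have hfinv : ∀ t : ℝ, f (t • e) = f 0 := by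
    intro t
    have h1 := h.equation (0 + t • e)
    have h2 := h.equation 0
    simp only [hpart, hinv] at h1
    rw [zero_add] at h1
    rw [← h1, ← h2]
  obtain ⟨R, hR⟩ := hfc.isCompact.isBounded.exists_norm_le
  have h1 : (|R| + 1) • e ∈ tsupport f := subset_tsupport f (by
    rw [Function.mem_support, hfinv]; exact hf0)
  have h2 := hR _ h1
  rw [norm_smul, he, PiLp.norm_single] at h2
  simp only [norm_one, mul_one, Real.norm_eq_abs] at h2
  have h3 := le_abs_self (|R| + 1)
  have h4 := le_abs_self R
  linarith

variable {L : Fin d → ℕ}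

/-- A single bump function suffices as test datum: the discrete solutions agree by uniqueness, so
both coefficients have the same limit u. -/
theorem IsEffectiveCoefficient.unique {b : Torus L → ℝ} (hb : ∀ ω, |b ω| < 1 / (2 * (d : ℝ)))
    {q q' : ℝ} (h : IsEffectiveCoefficient L b q) (h' : IsEffectiveCoefficient L b q') :
    q = q' := by
  let φ : ContDiffBump (0 : EuclideanSpace ℝ (Fin d)) := ⟨1, 2, one_pos, one_lt_two⟩
  obtain ⟨u, U, hu, hU, hlim⟩ := h.2 φ φ.contDiff φ.hasCompactSupport
  obtain ⟨u', U', hu', hU', hlim'⟩ := h'.2 φ φ.contDiff φ.hasCompactSupport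
  have huu : u = u' := by
    funext x
    have h1 := hlim.tendsto_at (x, (0 : Torus L))
    have h2 := hlim'.tendsto_at (x, (0 : Torus L))
    refine tendsto_nhds_unique h1 (h2.congr' ?_)
    filter_upwards [self_mem_nhdsWithin] with ε hε
    rw [(hU ε hε).unique hb hε (hU' ε hε)]
  subst huu
  refine hu.coefficient_unique φ.hasCompactSupport ?_ hu'
  have : φ 0 = 1 := φ.one_of_mem_closedBall (by simp [φ])
  rw [this]
  exact one_ne_zero

end Homogenized

/-! ### Expansion of the walk generator on two-scale functions -/

section Expansion

open SchwartzMap LineDeriv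

variable {d : ℕ}

/-- The `i`-th partial derivative of a Schwartz function. -/
noncomputable abbrev partialD (i : Fin d) (w : 𝓢(EuclideanSpace ℝ (Fin d), ℝ)) :
    𝓢(EuclideanSpace ℝ (Fin d), ℝ) :=
  ∂_{EuclideanSpace.single i (1 : ℝ)} w

theorem latticePoint_add_single (ε : ℝ) (n : Fin d → ℤ) (i : Fin d) :
    latticePoint ε (n + Pi.single i 1)
      = latticePoint ε n + ε • EuclideanSpace.single i (1 : ℝ) := by
  ext j
  rcases eq_or_ne j i with rfl | h
  · simp [latticePoint, mul_add]
  · simp [latticePoint, h]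

theorem latticePoint_sub_single (ε : ℝ) (n : Fin d → ℤ) (i : Fin d) :
    latticePoint ε (n - Pi.single i 1)
      = latticePoint ε n + (-ε) • EuclideanSpace.single i (1 : ℝ) := by
  have := latticePoint_add_single ε (n - Pi.single i 1) i
  rw [sub_add_cancel] at this
  rw [this]
  simp

theorem norm_latticePoint_floor_sub_le {ε : ℝ} (hε : 0 < ε) (x : EuclideanSpace ℝ (Fin d)) :
    ‖latticePoint ε (fun i => ⌊x i / ε⌋) - x‖ ≤ d * ε := by
  have h1 : ∀ i, ‖(latticePoint ε (fun i => ⌊x i / ε⌋) - x) i‖ ≤ ε := by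
    intro i
    have h2 := Int.floor_le (x i / ε)
    have h3 := Int.lt_floor_add_one (x i / ε)
    rw [le_div_iff₀ hε] at h2
    rw [div_lt_iff₀ hε] at h3
    rw [Real.norm_eq_abs, abs_le]
    simp only [latticePoint, PiLp.sub_apply]
    constructor <;> nlinarith
  have h2 : ‖latticePoint ε (fun i => ⌊x i / ε⌋) - x‖ ^ 2 ≤ d * ε ^ 2 := by
    rw [EuclideanSpace.norm_sq_eq]
    calc _ ≤ ∑ _i : Fin d, ε ^ 2 :=
          Finset.sum_le_sum fun i _ => pow_le_pow_left₀ (norm_nonneg _) (h1 i) 2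
      _ = d * ε ^ 2 := by simp
  -- The natural factor √d is replaced by d to avoid the square root.
  have h3 : (d : ℝ) ≤ (d : ℝ) ^ 2 := by exact_mod_cast Nat.le_self_pow two_ne_zero d
  refine (pow_le_pow_iff_left₀ (norm_nonneg _) (by positivity) two_ne_zero).1 (h2.trans ?_)
  rw [mul_pow]
  exact mul_le_mul_of_nonneg_right h3 (by positivity)

theorem schwartz_exists_lipschitz {E : Type*} [NormedAddCommGroup E] [NormedSpace ℝ E]
    (w : 𝓢(E, ℝ)) : ∃ C, 0 ≤ C ∧ ∀ x y, |w x - w y| ≤ C * ‖x - y‖ := by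
  refine ⟨SchwartzMap.seminorm ℝ 0 0 (fderivCLM ℝ E ℝ w), apply_nonneg _ _, fun x y => ?_⟩
  have := (convex_univ : Convex ℝ (Set.univ : Set E)).norm_image_sub_le_of_norm_fderiv_le
    (𝕜 := ℝ) (f := w) (fun z _ => w.differentiableAt)
    (fun z _ => by
      rw [← fderivCLM_apply ℝ]
      exact SchwartzMap.norm_le_seminorm ℝ _ z) (Set.mem_univ y) (Set.mem_univ x)
  simpa using this

theorem exists_uniform_bound {ι : Type*} [Fintype ι] {p : ι → ℝ → Prop}
    (hmono : ∀ i C C', C ≤ C' → p i C → p i C') (h : ∀ i, ∃ C, 0 ≤ C ∧ p i C) :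
    ∃ C, 0 ≤ C ∧ ∀ i, p i C := by
  choose C hC₀ hC using h
  exact ⟨∑ i, C i, Finset.sum_nonneg fun i _ => hC₀ i, fun i =>
    hmono i _ _ (Finset.single_le_sum (fun j _ => hC₀ j) (Finset.mem_univ i)) (hC i)⟩

theorem exists_abs_le_torus {L : Fin d → ℕ} [∀ i, NeZero (L i)] (χ : Torus L → ℝ) : ∃ K, 0 ≤ K ∧ ∀ ω, |χ ω| ≤ K :=
  ⟨∑ ω, |χ ω|, Finset.sum_nonneg fun _ _ => abs_nonneg _, fun ω =>
    Finset.single_le_sum (f := fun ω => |χ ω|) (fun _ _ => abs_nonneg _) (Finset.mem_univ ω)⟩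

variable [NeZero d] {L : Fin d → ℕ} {b : Torus L → ℝ}

/-- The lattice function `(n, ω) ↦ χ(τ_n ω) w(ε n)`. -/
noncomputable def twoScale (L : Fin d → ℕ) (ε : ℝ) (χ : Torus L → ℝ)
    (w : EuclideanSpace ℝ (Fin d) → ℝ) (n : Fin d → ℤ) (ω : Torus L) : ℝ :=
  χ (translate L n ω) * w (latticePoint ε n)

theorem walkOp_twoScale (ε : ℝ) (χ : Torus L → ℝ) (w : EuclideanSpace ℝ (Fin d) → ℝ)
    (n : Fin d → ℤ) (ω : Torus L) : walkOp L b (twoScale L ε χ w) n ω =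
      stepAvg (b (translate L n ω))
        (fun i => χ (translate L n ω + unitVec L i)
          * w (latticePoint ε n + ε • EuclideanSpace.single i (1 : ℝ)))
        (fun i => χ (translate L n ω - unitVec L i)
          * w (latticePoint ε n + (-ε) • EuclideanSpace.single i (1 : ℝ))) := by
  simp only [walkOp, twoScale, translate_add_single, translate_sub_single,
    latticePoint_add_single, latticePoint_sub_single]

theorem cellOp_eq_sub_stepAvg (χ : Torus L → ℝ) (ω : Torus L) :
    cellOp L b χ ω = χ ω - stepAvg (b ω) (fun i => χ (ω + unitVec L i))
      (fun i => χ (ω - unitVec L i)) := by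
  rw [cellOp_apply, stepAvg]; ring

theorem sum_mul_driftOp (χ : Torus L → ℝ) (ω : Torus L) (y : Fin d → ℝ) :
    ∑ i, y i * driftOp L b i χ ω = stepAvg (b ω) (fun i => χ (ω + unitVec L i) * y i)
      (fun i => - (χ (ω - unitVec L i) * y i)) := by
  rw [stepAvg_eq_sum]
  refine Finset.sum_congr rfl fun i _ => ?_
  rcases eq_or_ne i 0 with rfl | hi
  · simp only [driftOp, if_true]; ring
  · simp only [driftOp, if_neg hi]; ring

theorem stepAvg_mul_const (β c : ℝ) (P M : Fin d → ℝ) :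
    stepAvg β (fun i => P i * c) (fun i => M i * c) = stepAvg β P M * c := by
  rw [stepAvg_eq_sum, stepAvg_eq_sum, Finset.sum_mul]
  exact Finset.sum_congr rfl fun i _ => by ring

theorem walkOp_add (U V : (Fin d → ℤ) → Torus L → ℝ) (n : Fin d → ℤ) (ω : Torus L) :
    walkOp L b (U + V) n ω = walkOp L b U n ω + walkOp L b V n ω := by
  have := walkOp_sub b (U + V) V n ω
  rw [add_sub_cancel_right] at this
  linarith

theorem walkOp_smul (c : ℝ) (U : (Fin d → ℤ) → Torus L → ℝ) (n : Fin d → ℤ) (ω : Torus L) :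
    walkOp L b (c • U) n ω = c * walkOp L b U n ω := by
  rw [walkOp, walkOp, mul_comm, ← stepAvg_mul_const]
  simp only [Pi.smul_apply, smul_eq_mul, mul_comm]

theorem walkOp_sum {ι : Type*} (s : Finset ι) (U : ι → (Fin d → ℤ) → Torus L → ℝ)
    (n : Fin d → ℤ) (ω : Torus L) :
    walkOp L b (∑ i ∈ s, U i) n ω = ∑ i ∈ s, walkOp L b (U i) n ω := by
  classical
  induction s using Finset.induction_on with
  | empty => simp [walkOp, stepAvg]
  | insert i s hi ih => rw [Finset.sum_insert hi, Finset.sum_insert hi, walkOp_add, ih]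

/-- The expansion of the walk generator on `w(ε n)` to second order. -/
theorem exists_twoScale_expansion_two (hb : ∀ ω, |b ω| < 1 / (2 * (d : ℝ)))
    (w : 𝓢(EuclideanSpace ℝ (Fin d), ℝ)) : ∃ C, 0 ≤ C ∧ ∀ (ε : ℝ) n ω, 0 < ε →
      |twoScale L ε 1 w n ω - walkOp L b (twoScale L ε 1 w) n ω
        + ε * (2 * b (translate L n ω)
          * partialD 0 w (latticePoint ε n))
        + ε ^ 2 * (1 / (2 * (d : ℝ)) * ∑ i, partialD i (partialD i w) (latticePoint ε n))| ≤ C * ε ^ 3 := by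
  obtain ⟨C, hC₀, hC⟩ := exists_uniform_bound (ι := Fin d)
    (p := fun i C => ∀ x (t : ℝ), |w (x + t • EuclideanSpace.single i (1 : ℝ)) - w x
      - t * partialD i w x
      - t ^ 2 / 2 * partialD i (partialD i w) x| ≤ C * |t| ^ 3)
    (fun i C C' h hp x t => (hp x t).trans (mul_le_mul_of_nonneg_right h (by positivity)))
    (fun i => schwartz_exists_abs_sub_le_cube w _)
  refine ⟨C, hC₀, fun ε n ω hε => ?_⟩
  set η := translate L n ω with hη
  set x := latticePoint ε n with hx
  -- The error is exactly the average of the Taylor remainders at the neighbours. The weights are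
  -- nonnegative with sum 1, so a bound on each remainder passes to the average. The two lower-order
  -- expansions below rest on the same remark.
  have key : twoScale L ε 1 w n ω - walkOp L b (twoScale L ε 1 w) n ω
        + ε * (2 * b η * partialD 0 w x)
        + ε ^ 2 * (1 / (2 * (d : ℝ)) * ∑ i, partialD i (partialD i w) x)
      = - stepAvg (b η)
        (fun i => w (x + ε • EuclideanSpace.single i (1 : ℝ)) - w x
          - ε * partialD i w x
          - ε ^ 2 / 2 * partialD i (partialD i w) x)
        (fun i => w (x + (-ε) • EuclideanSpace.single i (1 : ℝ)) - w x
          - (-ε) * partialD i w x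
          - (-ε) ^ 2 / 2 * partialD i (partialD i w) x) := by
    rw [walkOp_twoScale, ← hη, ← hx, stepAvg_sub, stepAvg_sub, stepAvg_sub, twoScale, ← hη, ← hx]
    simp only [Pi.one_apply, one_mul]
    have h1 : stepAvg (b η) (fun _ => w x) (fun _ : Fin d => w x) = w x := by
      simp only [stepAvg, ← two_mul, sum_inv_two_mul_dim]; ring
    have h2 : stepAvg (b η) (fun i : Fin d => ε * partialD i w x)
        (fun i => (-ε) * partialD i w x)
        = ε * (2 * b η * partialD 0 w x) := by
      have : ∀ i : Fin d, 1 / (2 * (d : ℝ)) * (ε * partialD i w x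
        + (-ε) * partialD i w x) = 0 := fun i => by ring
      simp only [stepAvg, this, Finset.sum_const_zero]
      ring
    have h3 : stepAvg (b η) (fun i : Fin d => ε ^ 2 / 2 * partialD i (partialD i w) x)
        (fun i => (-ε) ^ 2 / 2 * partialD i (partialD i w) x)
        = ε ^ 2 * (1 / (2 * (d : ℝ)) * ∑ i, partialD i (partialD i w) x) := by
      rw [stepAvg, Finset.mul_sum, Finset.mul_sum, neg_sq, sub_self, mul_zero, add_zero]
      exact Finset.sum_congr rfl fun i _ => by ring
    rw [h1, h2, h3]
    ring
  rw [key, abs_neg]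
  refine abs_stepAvg_le (hb η) (fun i => ?_) (fun i => ?_)
  · have := hC i x ε
    rwa [abs_of_pos hε] at this
  · have := hC i x (-ε)
    rwa [abs_neg, abs_of_pos hε] at this

variable [∀ i, NeZero (L i)]

/-- The expansion of the walk generator on `χ(τ_n ω) w(ε n)` to order zero. -/
theorem exists_twoScale_expansion_zero (hb : ∀ ω, |b ω| < 1 / (2 * (d : ℝ))) (χ : Torus L → ℝ)
    (w : 𝓢(EuclideanSpace ℝ (Fin d), ℝ)) : ∃ C, 0 ≤ C ∧ ∀ (ε : ℝ) n ω, 0 < ε →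
      |twoScale L ε χ w n ω - walkOp L b (twoScale L ε χ w) n ω
        - cellOp L b χ (translate L n ω) * w (latticePoint ε n)| ≤ C * ε := by
  obtain ⟨K, hK₀, hK⟩ := exists_abs_le_torus χ
  obtain ⟨C, hC₀, hC⟩ := exists_uniform_bound (ι := Fin d)
    (p := fun i C => ∀ x (t : ℝ), |w (x + t • EuclideanSpace.single i (1 : ℝ)) - w x| ≤ C * |t|)
    (fun i C C' h hp x t => (hp x t).trans (mul_le_mul_of_nonneg_right h (abs_nonneg t)))
    (fun i => schwartz_exists_abs_sub_le w _)
  refine ⟨K * C, by positivity, fun ε n ω hε => ?_⟩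
  set η := translate L n ω with hη
  set x := latticePoint ε n with hx
  have key : twoScale L ε χ w n ω - walkOp L b (twoScale L ε χ w) n ω - cellOp L b χ η * w x
      = - stepAvg (b η)
        (fun i => χ (η + unitVec L i) * (w (x + ε • EuclideanSpace.single i (1 : ℝ)) - w x))
        (fun i => χ (η - unitVec L i) * (w (x + (-ε) • EuclideanSpace.single i (1 : ℝ)) - w x)) := by
    simp only [mul_sub]
    rw [walkOp_twoScale, ← hη, ← hx, cellOp_eq_sub_stepAvg, stepAvg_sub, stepAvg_mul_const,
      twoScale, ← hη, ← hx]
    ring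
  rw [key, abs_neg, mul_assoc]
  refine abs_stepAvg_le (hb η) (fun i => ?_) (fun i => ?_)
  · rw [abs_mul]
    have := hC i x ε
    rw [abs_of_pos hε] at this
    exact mul_le_mul (hK _) this (abs_nonneg _) hK₀
  · rw [abs_mul]
    have := hC i x (-ε)
    rw [abs_neg, abs_of_pos hε] at this
    exact mul_le_mul (hK _) this (abs_nonneg _) hK₀

/-- The expansion of the walk generator on `χ(τ_n ω) w(ε n)` to first order. -/
theorem exists_twoScale_expansion_one (hb : ∀ ω, |b ω| < 1 / (2 * (d : ℝ))) (χ : Torus L → ℝ)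
    (w : 𝓢(EuclideanSpace ℝ (Fin d), ℝ)) : ∃ C, 0 ≤ C ∧ ∀ (ε : ℝ) n ω, 0 < ε →
      |twoScale L ε χ w n ω - walkOp L b (twoScale L ε χ w) n ω
        - cellOp L b χ (translate L n ω) * w (latticePoint ε n)
        + ε * ∑ i, partialD i w (latticePoint ε n)
          * driftOp L b i χ (translate L n ω)| ≤ C * ε ^ 2 := by
  obtain ⟨K, hK₀, hK⟩ := exists_abs_le_torus χ
  obtain ⟨C, hC₀, hC⟩ := exists_uniform_bound (ι := Fin d)
    (p := fun i C => ∀ x (t : ℝ), |w (x + t • EuclideanSpace.single i (1 : ℝ)) - w x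
      - t * partialD i w x| ≤ C * |t| ^ 2)
    (fun i C C' h hp x t => (hp x t).trans (mul_le_mul_of_nonneg_right h (by positivity)))
    (fun i => schwartz_exists_abs_sub_le_sq w _)
  refine ⟨K * C, by positivity, fun ε n ω hε => ?_⟩
  set η := translate L n ω with hη
  set x := latticePoint ε n with hx
  have key : twoScale L ε χ w n ω - walkOp L b (twoScale L ε χ w) n ω - cellOp L b χ η * w x
        + ε * ∑ i, partialD i w x * driftOp L b i χ η
      = - stepAvg (b η)
        (fun i => χ (η + unitVec L i) * (w (x + ε • EuclideanSpace.single i (1 : ℝ)) - w x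
          - ε * partialD i w x))
        (fun i => χ (η - unitVec L i) * (w (x + (-ε) • EuclideanSpace.single i (1 : ℝ)) - w x
          - (-ε) * partialD i w x)) := by
    rw [sum_mul_driftOp, mul_comm ε (stepAvg _ _ _), ← stepAvg_mul_const]
    have h1 : ∀ i, χ (η + unitVec L i) * (ε * partialD i w x)
        = χ (η + unitVec L i) * partialD i w x * ε := fun i => by ring
    have h2 : ∀ i, χ (η - unitVec L i) * (-ε * partialD i w x)
        = -(χ (η - unitVec L i) * partialD i w x) * ε :=
      fun i => by ring
    simp only [mul_sub, h1, h2]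
    rw [walkOp_twoScale, ← hη, ← hx, cellOp_eq_sub_stepAvg, stepAvg_sub, stepAvg_sub,
      stepAvg_mul_const _ (w x), twoScale, ← hη, ← hx]
    ring
  rw [key, abs_neg, mul_assoc]
  refine abs_stepAvg_le (hb η) (fun i => ?_) (fun i => ?_)
  · rw [abs_mul]
    have := hC i x ε
    rw [abs_of_pos hε] at this
    exact mul_le_mul (hK _) this (abs_nonneg _) hK₀
  · rw [abs_mul]
    have := hC i x (-ε)
    rw [abs_neg, abs_of_pos hε] at this
    exact mul_le_mul (hK _) this (abs_nonneg _) hK₀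

end Expansion

/-! ### Convergence to the homogenized solution -/

section Convergence

open SchwartzMap LineDeriv

variable {d : ℕ} {L : Fin d → ℕ}

theorem exists_abs_twoScale_le [∀ i, NeZero (L i)] (χ : Torus L → ℝ)
    (w : 𝓢(EuclideanSpace ℝ (Fin d), ℝ)) :
    ∃ C, 0 ≤ C ∧ ∀ ε n ω, |twoScale L ε χ w n ω| ≤ C := by
  obtain ⟨K, hK₀, hK⟩ := exists_abs_le_torus χ
  obtain ⟨C, hC₀, hC⟩ := schwartz_exists_abs_le w
  refine ⟨K * C, by positivity, fun ε n ω => ?_⟩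
  rw [twoScale, abs_mul]
  exact mul_le_mul (hK _) (hC _) (abs_nonneg _) hK₀

variable [NeZero d]

/-- The two-scale expansion `u + ε ψ ∂₁u + ε² ∑ χ_i ∂_i ∂₁u`. -/
noncomputable def ansatz (L : Fin d → ℕ) (ε : ℝ) (ψ : Torus L → ℝ) (χ : Fin d → Torus L → ℝ)
    (u : 𝓢(EuclideanSpace ℝ (Fin d), ℝ)) : (Fin d → ℤ) → Torus L → ℝ :=
  twoScale L ε 1 u + (ε • twoScale L ε ψ (partialD 0 u)
    + ε ^ 2 • ∑ i, twoScale L ε (χ i) (partialD i (partialD 0 u)))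

variable [∀ i, NeZero (L i)]

theorem exists_abs_ansatz_sub_le (ψ : Torus L → ℝ) (χ : Fin d → Torus L → ℝ)
    (u : 𝓢(EuclideanSpace ℝ (Fin d), ℝ)) : ∃ C, 0 ≤ C ∧ ∀ ε n ω, 0 < ε → ε ≤ 1 →
      |ansatz L ε ψ χ u n ω - u (latticePoint ε n)| ≤ C * ε := by
  obtain ⟨A, hA₀, hA⟩ := exists_abs_twoScale_le ψ (partialD 0 u)
  obtain ⟨B, hB₀, hB⟩ := exists_uniform_bound (ι := Fin d)
    (p := fun i C => ∀ ε n ω, |twoScale L ε (χ i) (partialD i (partialD 0 u)) n ω| ≤ C)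
    (fun i C C' h hp ε n ω => (hp ε n ω).trans h)
    (fun i => exists_abs_twoScale_le (χ i) _)
  refine ⟨A + d * B, by positivity, fun ε n ω hε hε1 => ?_⟩
  have h1 : ansatz L ε ψ χ u n ω - u (latticePoint ε n)
      = ε * (twoScale L ε ψ (partialD 0 u) n ω
        + ε * ∑ i, twoScale L ε (χ i) (partialD i (partialD 0 u)) n ω) := by
    simp only [ansatz, Pi.add_apply, Pi.smul_apply, smul_eq_mul, Finset.sum_apply]
    rw [twoScale]
    simp only [Pi.one_apply]
    ring
  have h2 : |∑ i, twoScale L ε (χ i) (partialD i (partialD 0 u)) n ω| ≤ d * B := by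
    refine (Finset.abs_sum_le_sum_abs _ _).trans ?_
    refine (Finset.sum_le_sum fun i _ => hB i ε n ω).trans ?_
    simp
  rw [h1, abs_mul, abs_of_pos hε, mul_comm]
  refine mul_le_mul_of_nonneg_right ((abs_add_le _ _).trans (add_le_add (hA ε n ω) ?_)) hε.le
  rw [abs_mul, abs_of_pos hε]
  calc _ ≤ 1 * (d * B) := mul_le_mul hε1 h2 (abs_nonneg _) zero_le_one
    _ = _ := one_mul _

/-- At order ε the term -2b ∂₁u cancels against A ψ ∂₁u. At order ε² the equations for the χ_i
cancel the oscillating terms and change the coefficient of ∂₁²u from 1/(2d) to q, leaving the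
homogenized equation. The terms carry factors 1, ε, ε², so they need expansions to orders two, one
and zero. -/
theorem IsCorrector.exists_residual_le {b : Torus L → ℝ} (hb : ∀ ω, |b ω| < 1 / (2 * (d : ℝ)))
    {q : ℝ} {ψ : Torus L → ℝ} {χ : Fin d → Torus L → ℝ} (h : IsCorrector L b q ψ χ)
    {f : EuclideanSpace ℝ (Fin d) → ℝ} {u : 𝓢(EuclideanSpace ℝ (Fin d), ℝ)}
    (hu : IsHomogenizedSolution q f u) : ∃ C, 0 ≤ C ∧ ∀ ε n ω, 0 < ε → ε ≤ 1 →
      |ansatz L ε ψ χ u n ω - walkOp L b (ansatz L ε ψ χ u) n ω + ε ^ 2 * ansatz L ε ψ χ u n ω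
        - ε ^ 2 * f (latticePoint ε n)| ≤ ε ^ 2 * (C * ε) := by
  obtain ⟨A₀, hA₀, hA⟩ := exists_twoScale_expansion_two hb u
  obtain ⟨B₀, hB₀, hB⟩ := exists_twoScale_expansion_one hb ψ (partialD 0 u)
  obtain ⟨D₀, hD₀, hD⟩ := exists_uniform_bound (ι := Fin d)
    (p := fun i C => ∀ (ε : ℝ) n ω, 0 < ε →
      |twoScale L ε (χ i) (partialD i (partialD 0 u)) n ω
        - walkOp L b (twoScale L ε (χ i) (partialD i (partialD 0 u))) n ω
        - cellOp L b (χ i) (translate L n ω) * partialD i (partialD 0 u) (latticePoint ε n)|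
        ≤ C * ε)
    (fun i C C' h hp ε n ω hε => (hp ε n ω hε).trans (mul_le_mul_of_nonneg_right h hε.le))
    (fun i => exists_twoScale_expansion_zero hb (χ i) _)
  obtain ⟨F₀, hF₀, hF⟩ := exists_abs_ansatz_sub_le ψ χ u
  refine ⟨A₀ + B₀ + d * D₀ + F₀, by positivity, fun ε n ω hε hε1 => ?_⟩
  have hA := hA ε n ω hε
  have hB := hB ε n ω hε
  have hD := fun i => hD i ε n ω hε
  have hF := hF ε n ω hε hε1
  have hpde := hu.equation (latticePoint ε n)
  set η := translate L n ω
  set x := latticePoint ε n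
  simp only [schwartz_secondPartial_eq] at hpde
  have hsplit : ∑ i, partialD i (partialD i u) x = partialD 0 (partialD 0 u) x
      + ∑ i ∈ Finset.univ.erase (0 : Fin d), partialD i (partialD i u) x :=
    (Finset.add_sum_erase _ _ (Finset.mem_univ _)).symm
  rw [← Finset.mul_sum] at hpde
  rw [hsplit] at hA
  have hD2 : |∑ i, (twoScale L ε (χ i) (partialD i (partialD 0 u)) n ω
        - walkOp L b (twoScale L ε (χ i) (partialD i (partialD 0 u))) n ω
        - cellOp L b (χ i) η * partialD i (partialD 0 u) x)| ≤ d * D₀ * ε := by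
    refine (Finset.abs_sum_le_sum_abs _ _).trans ?_
    refine (Finset.sum_le_sum fun i _ => hD i).trans (le_of_eq ?_)
    simp [mul_assoc]
  have hcell : ∑ i, cellOp L b (χ i) η * partialD i (partialD 0 u) x
      = ∑ i, partialD i (partialD 0 u) x * driftOp L b i ψ η
        + (1 / (2 * (d : ℝ)) - q) * partialD 0 (partialD 0 u) x := by
    have h1 : (1 / (2 * (d : ℝ)) - q) * partialD 0 (partialD 0 u) x
        = ∑ i, if i = 0 then (1 / (2 * (d : ℝ)) - q) * partialD i (partialD 0 u) x else 0 := by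
      simp
    rw [h1, ← Finset.sum_add_distrib]
    refine Finset.sum_congr rfl fun i _ => ?_
    rw [h.second]
    split_ifs <;> ring
  rw [Finset.sum_sub_distrib, Finset.sum_sub_distrib, hcell] at hD2
  rw [h.first] at hB
  have hW : walkOp L b (ansatz L ε ψ χ u) n ω = walkOp L b (twoScale L ε 1 u) n ω
      + (ε * walkOp L b (twoScale L ε ψ (partialD 0 u)) n ω
      + ε ^ 2 * ∑ i, walkOp L b (twoScale L ε (χ i) (partialD i (partialD 0 u))) n ω) := by
    rw [ansatz, walkOp_add, walkOp_add, walkOp_smul, walkOp_smul, walkOp_sum]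
  have hV : ansatz L ε ψ χ u n ω = twoScale L ε 1 u n ω
      + (ε * twoScale L ε ψ (partialD 0 u) n ω
      + ε ^ 2 * ∑ i, twoScale L ε (χ i) (partialD i (partialD 0 u)) n ω) := by
    simp only [ansatz, Pi.add_apply, Pi.smul_apply, smul_eq_mul, Finset.sum_apply]
  have key : ansatz L ε ψ χ u n ω - walkOp L b (ansatz L ε ψ χ u) n ω
      + ε ^ 2 * ansatz L ε ψ χ u n ω - ε ^ 2 * f x
      = (twoScale L ε 1 u n ω - walkOp L b (twoScale L ε 1 u) n ω
        + ε * (2 * b η * partialD 0 u x) + ε ^ 2 * (1 / (2 * (d : ℝ)) *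
          (partialD 0 (partialD 0 u) x
            + ∑ i ∈ Finset.univ.erase (0 : Fin d), partialD i (partialD i u) x)))
      + ε * (twoScale L ε ψ (partialD 0 u) n ω
        - walkOp L b (twoScale L ε ψ (partialD 0 u)) n ω - 2 * b η * partialD 0 u x
        + ε * ∑ i, partialD i (partialD 0 u) x * driftOp L b i ψ η)
      + ε ^ 2 * (∑ i, twoScale L ε (χ i) (partialD i (partialD 0 u)) n ω
        - ∑ i, walkOp L b (twoScale L ε (χ i) (partialD i (partialD 0 u))) n ω
        - (∑ i, partialD i (partialD 0 u) x * driftOp L b i ψ η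
        + (1 / (2 * (d : ℝ)) - q) * partialD 0 (partialD 0 u) x))
      + ε ^ 2 * (ansatz L ε ψ χ u n ω - u x) := by
    rw [← hpde, hW]
    nth_rw 1 [hV]
    ring
  rw [key]
  have hε2 : 0 ≤ ε ^ 2 := by positivity
  have e1 := mul_le_mul_of_nonneg_left hB hε.le
  have e2 := mul_le_mul_of_nonneg_left hD2 hε2
  have e3 := mul_le_mul_of_nonneg_left hF hε2
  rw [← abs_of_nonneg hε.le, ← abs_mul, abs_of_nonneg hε.le] at e1
  rw [← abs_of_nonneg hε2, ← abs_mul, abs_of_nonneg hε2] at e2 e3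
  refine (abs_add_le _ _).trans (le_trans (add_le_add ((abs_add_le _ _).trans
    (add_le_add ((abs_add_le _ _).trans (add_le_add hA e1)) e2)) e3) (le_of_eq ?_))
  ring

/-- The maximum principle compares the expansion with the discrete solution. The correctors
themselves and the rounding of x to the lattice each cost another O(ε). -/
theorem IsCorrector.isEffectiveCoefficient {b : Torus L → ℝ} (hb : IsAdmissible L b)
    {q : ℝ} {ψ : Torus L → ℝ} {χ : Fin d → Torus L → ℝ} (h : IsCorrector L b q ψ χ) :
    IsEffectiveCoefficient L b q := by
  refine ⟨h.pos hb, fun f hf hfc => ?_⟩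
  obtain ⟨u, hu⟩ := exists_isHomogenizedSolution (h.pos hb) hf hfc
  have hfb : ∃ C, ∀ x, |f x| ≤ C := by
    obtain ⟨C, -, hC⟩ := schwartz_exists_abs_le (hfc.toSchwartzMap hf)
    exact ⟨C, hC⟩
  have hex : ∀ ε : ℝ, ∃ U, 0 < ε → IsDiscreteSolution L b f ε U := fun ε => by
    by_cases hε : 0 < ε
    · obtain ⟨U, hU⟩ := exists_isDiscreteSolution hb.abs_lt hfb hε
      exact ⟨U, fun _ => hU⟩
    · exact ⟨0, fun h => absurd h hε⟩
  choose U hU using hex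
  refine ⟨u, U, hu, hU, ?_⟩
  obtain ⟨C₁, hC₁, h₁⟩ := h.exists_residual_le hb.abs_lt hu
  obtain ⟨C₂, hC₂, h₂⟩ := exists_abs_ansatz_sub_le ψ χ u
  obtain ⟨C₃, hC₃, h₃⟩ := schwartz_exists_lipschitz u
  obtain ⟨C₄, hC₄, h₄⟩ := schwartz_exists_abs_le u
  have hbound : ∀ ε : ℝ, 0 < ε → ε ≤ 1 → ∀ (x : EuclideanSpace ℝ (Fin d)) (ω : Torus L),
      |U ε (fun i => ⌊x i / ε⌋) ω - u x| ≤ (C₁ + C₂ + C₃ * d) * ε := by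
    intro ε hε hε1 x ω
    set n : Fin d → ℤ := fun i => ⌊x i / ε⌋
    obtain ⟨⟨C₅, hC₅⟩, hUeq⟩ := isDiscreteSolution_iff.1 (hU ε hε)
    have hWb : ∃ C, ∀ n ω, |(ansatz L ε ψ χ u - U ε) n ω| ≤ C := by
      refine ⟨C₂ * ε + C₄ + C₅, fun n ω => ?_⟩
      have e1 := h₂ ε n ω hε hε1
      have e2 := h₄ (latticePoint ε n)
      have e3 := hC₅ n ω
      simp only [Pi.sub_apply]
      rw [abs_le] at *
      constructor <;> linarith
    have hmax := abs_le_of_abs_equation_le hb.abs_lt hε hWb (M := C₁ * ε) (fun n ω => by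
      have e1 := h₁ ε n ω hε hε1
      have e2 := hUeq n ω
      rw [walkOp_sub]
      simp only [Pi.sub_apply]
      have e3 : ansatz L ε ψ χ u n ω - U ε n ω
          - (walkOp L b (ansatz L ε ψ χ u) n ω - walkOp L b (U ε) n ω)
          + ε ^ 2 * (ansatz L ε ψ χ u n ω - U ε n ω)
          = ansatz L ε ψ χ u n ω - walkOp L b (ansatz L ε ψ χ u) n ω
          + ε ^ 2 * ansatz L ε ψ χ u n ω - ε ^ 2 * f (latticePoint ε n) := by
        linear_combination -e2
      rw [e3]
      exact e1) n ω
    have e1 := h₂ ε n ω hε hε1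
    have e2 := (h₃ (latticePoint ε n) x).trans
      (mul_le_mul_of_nonneg_left (norm_latticePoint_floor_sub_le hε x) hC₃)
    simp only [Pi.sub_apply] at hmax
    rw [abs_le] at *
    constructor <;> linarith
  rw [Metric.tendstoUniformly_iff]
  intro δ hδ
  set C := C₁ + C₂ + C₃ * d
  have hC : 0 ≤ C := by positivity
  have hpos : 0 < min 1 (δ / (C + 1)) := by positivity
  filter_upwards [Ioo_mem_nhdsGT hpos] with ε hε p
  have hε1 := (lt_min_iff.1 hε.2).1
  have hε2 := (lt_min_iff.1 hε.2).2
  rw [lt_div_iff₀ (by positivity)] at hε2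
  rw [dist_comm, Real.dist_eq]
  have := hbound ε hε.1 hε1.le p.1 p.2
  have := hε.1
  nlinarith

/-- Every effective coefficient is given by the correctors. -/
theorem IsEffectiveCoefficient.exists_isCorrector {b : Torus L → ℝ} (hb : IsAdmissible L b)
    {q : ℝ} (hq : IsEffectiveCoefficient L b q) : ∃ ψ χ, IsCorrector L b q ψ χ := by
  obtain ⟨q', ψ, χ, h⟩ := Homogenization.exists_isCorrector hb
  obtain rfl := (h.isEffectiveCoefficient hb).unique hb.abs_lt hq
  exact ⟨ψ, χ, h⟩

theorem existsUnique_isEffectiveCoefficient {b : Torus L → ℝ} (hb : IsAdmissible L b) :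
    ∃! q : ℝ, IsEffectiveCoefficient L b q := by
  obtain ⟨q, ψ, χ, h⟩ := exists_isCorrector hb
  exact ⟨q, h.isEffectiveCoefficient hb, fun q' hq' =>
    hq'.unique hb.abs_lt (h.isEffectiveCoefficient hb)⟩

end Convergence

/-! ### A quadratic form inequality for two rows exchanged by an involution -/

section TwoRow

/-- The sign of the correction to the effective coefficient for two rows exchanged by an
involution `S`: here `T` is a nonnegative symmetric operator commuting with `S`. -/
theorem nonneg_of_involution {Ω : Type*} [Fintype Ω] [Nonempty Ω] {S : Ω → Ω}
    (hS : ∀ ω, S (S ω) = ω) (T : (Ω → ℝ) →ₗ[ℝ] (Ω → ℝ))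
    (hTsym : ∀ F G : Ω → ℝ, ∑ ω, F ω * T G ω = ∑ ω, G ω * T F ω)
    (hTpos : ∀ F : Ω → ℝ, 0 ≤ ∑ ω, F ω * T F ω) (hT1 : ∀ F : Ω → ℝ, ∑ ω, T F ω = 0)
    (hTS : ∀ (F : Ω → ℝ) ω, T (fun ω => F (S ω)) ω = T F (S ω))
    {B f χ : Ω → ℝ} {c : ℝ} (hB : ∀ ω, |B ω| < 1)
    (hf : ∀ ω, T f ω + (3 - B ω) * f ω + (1 + B ω) * f (S ω) = 2 * B ω)
    (hχ : ∀ ω, T χ ω + (1 + B ω) * (χ ω - χ (S ω))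
      = (1 - B ω) * f ω - (1 + B ω) * f (S ω) + c) : 0 ≤ c := by
  have hsumS : ∀ F : Ω → ℝ, ∑ ω, F (S ω) = ∑ ω, F ω := fun F =>
    Equiv.sum_comp (Function.Involutive.toPerm S hS) F
  have hsolve : ∀ v : Ω → ℝ, (∀ ω, 0 < v ω) →
      Function.Bijective (T + LinearMap.mulLeft ℝ v) := by
    intro v hv
    have hinj : Function.Injective (T + LinearMap.mulLeft ℝ v) := by
      rw [injective_iff_map_eq_zero]
      intro F hF
      have h1 : ∑ ω, F ω * T F ω + ∑ ω, v ω * F ω ^ 2 = 0 := by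
        rw [← Finset.sum_add_distrib]
        refine Finset.sum_eq_zero fun ω _ => ?_
        have := congrFun hF ω
        simp only [LinearMap.add_apply, LinearMap.mulLeft_apply, Pi.add_apply, Pi.mul_apply,
          Pi.zero_apply] at this
        linear_combination F ω * this
      have h2 : ∀ ω ∈ Finset.univ, 0 ≤ v ω * F ω ^ 2 := fun ω _ =>
        mul_nonneg (hv ω).le (sq_nonneg _)
      have h3 := (Finset.sum_eq_zero_iff_of_nonneg h2).1
        (le_antisymm (by linarith [hTpos F]) (Finset.sum_nonneg h2))
      funext ω
      exact pow_eq_zero_iff two_ne_zero |>.1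
        ((mul_eq_zero.1 (h3 ω (Finset.mem_univ ω))).resolve_left (hv ω).ne')
    exact ⟨hinj, LinearMap.injective_iff_surjective.1 hinj⟩
  -- `w` is even and `t` odd under `S`. The function `n` below is chosen so that 1 - n is
  -- annihilated by the adjoint of the operator acting on `χ`; `μ` and `x` are the odd and even
  -- parts of `f`.
  set w : Ω → ℝ := fun ω => B ω + B (S ω) with hw
  set t : Ω → ℝ := fun ω => B ω - B (S ω) with ht
  have hw2 : ∀ ω, 0 < 2 + w ω := fun ω => by
    have h1 := abs_lt.1 (hB ω)
    have h2 := abs_lt.1 (hB (S ω))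
    simp only [hw]; linarith
  obtain ⟨n, hn⟩ := (hsolve (fun ω => 2 + w ω) hw2).2 t
  replace hn : ∀ ω, T n ω + (2 + w ω) * n ω = t ω := fun ω => congrFun hn ω
  have hnS : ∀ ω, n (S ω) = - n ω := by
    have h1 : (n + fun ω => n (S ω)) = 0 := by
      refine (hsolve (fun ω => 2 + w ω) hw2).1 ?_
      rw [map_zero]
      funext ω
      have h2 := hn ω
      have h3 := hn (S ω)
      simp only [LinearMap.add_apply, LinearMap.mulLeft_apply, Pi.add_apply, Pi.mul_apply,
        Pi.zero_apply, map_add, hTS]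
      simp only [hw, ht, hS] at h2 h3 ⊢
      linear_combination h2 + h3
    intro ω
    have := congrFun h1 ω
    simp only [Pi.add_apply, Pi.zero_apply] at this
    linarith
  -- `z` solves the equation of `x` with -n in place of μ, so x and z differ only through t(μ + n).
  obtain ⟨z, hz⟩ := (hsolve (fun _ => 4) (fun _ => by norm_num)).2 (fun ω => w ω - t ω * n ω)
  replace hz : ∀ ω, T z ω + 4 * z ω = w ω - t ω * n ω := fun ω => congrFun hz ω
  set μ : Ω → ℝ := (1 / 2 : ℝ) • (f - fun ω => f (S ω)) with hμ
  set x : Ω → ℝ := (1 / 2 : ℝ) • (f + fun ω => f (S ω)) with hx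
  have hμapp : ∀ ω, μ ω = 1 / 2 * (f ω - f (S ω)) := fun ω => rfl
  have hxapp : ∀ ω, x ω = 1 / 2 * (f ω + f (S ω)) := fun ω => rfl
  have hTμ : ∀ ω, T μ ω + 2 * μ ω - w ω * μ ω = t ω := by
    intro ω
    have h2 := hf ω
    have h3 := hf (S ω)
    rw [hμapp, hμ, map_smul, map_sub, Pi.smul_apply, Pi.sub_apply, hTS, smul_eq_mul]
    simp only [hw, ht, hS] at h3 ⊢
    linear_combination 1 / 2 * h2 - 1 / 2 * h3
  have hTx : ∀ ω, T x ω + 4 * x ω = w ω + t ω * μ ω := by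
    intro ω
    have h2 := hf ω
    have h3 := hf (S ω)
    rw [hμapp, hxapp, hx, map_smul, map_add, Pi.smul_apply, Pi.add_apply, hTS, smul_eq_mul]
    simp only [hw, ht, hS] at h3 ⊢
    linear_combination 1 / 2 * h2 + 1 / 2 * h3
  -- testing the equation for `χ` with the invariant density `1 - n`
  have htest : ∑ ω, (1 - n ω) * (T χ ω + (1 + B ω) * (χ ω - χ (S ω))) = 0 := by
    have h1 : ∑ ω, (1 - n ω) * (1 + B ω) * χ (S ω)
        = ∑ ω, (1 + n ω) * (1 + B (S ω)) * χ ω := by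
      rw [← hsumS]
      refine Finset.sum_congr rfl fun ω _ => ?_
      rw [hnS, hS]; ring
    have h2 : ∑ ω, n ω * T χ ω = ∑ ω, χ ω * (t ω - (2 + w ω) * n ω) := by
      rw [hTsym]
      refine Finset.sum_congr rfl fun ω _ => ?_
      rw [← hn]; ring
    have h3 : ∑ ω, (1 - n ω) * (T χ ω + (1 + B ω) * (χ ω - χ (S ω)))
        = ∑ ω, T χ ω - ∑ ω, n ω * T χ ω + ∑ ω, (1 - n ω) * (1 + B ω) * χ ω
          - ∑ ω, (1 - n ω) * (1 + B ω) * χ (S ω) := by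
      rw [← Finset.sum_sub_distrib, ← Finset.sum_add_distrib, ← Finset.sum_sub_distrib]
      exact Finset.sum_congr rfl fun ω _ => by ring
    rw [h3, h1, h2, hT1, zero_sub, ← Finset.sum_neg_distrib, ← Finset.sum_add_distrib,
      ← Finset.sum_sub_distrib]
    refine Finset.sum_eq_zero fun ω _ => ?_
    simp only [hw, ht]; ring
  have hn0 : ∑ ω, n ω = 0 := by
    have h1 := hsumS n
    simp only [hnS, Finset.sum_neg_distrib] at h1
    linarith
  have hc : c * Fintype.card Ω = ∑ ω, (2 * (n ω * μ ω) + x ω * (w ω - t ω * n ω)) := by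
    have h1 : ∑ ω, (1 - n ω) * ((1 - B ω) * f ω - (1 + B ω) * f (S ω)) + c * Fintype.card Ω
        = 0 := by
      have h2 : c * Fintype.card Ω = ∑ ω, (1 - n ω) * c := by
        rw [← Finset.sum_mul, Finset.sum_sub_distrib, hn0]
        simp [mul_comm]
      rw [← htest, h2, ← Finset.sum_add_distrib]
      exact Finset.sum_congr rfl fun ω _ => by rw [hχ ω, mul_add]
    have h2 : ∑ ω, (1 - n ω) * ((1 - B ω) * f ω - (1 + B ω) * f (S ω))
        = ∑ ω, (1 + n ω) * ((1 - B (S ω)) * f (S ω) - (1 + B (S ω)) * f ω) := by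
      rw [← hsumS]
      refine Finset.sum_congr rfl fun ω _ => ?_
      rw [hnS, hS]; ring
    have h3 : ∑ ω, (2 * (n ω * μ ω) + x ω * (w ω - t ω * n ω))
        = -(1 / 2) * (∑ ω, (1 - n ω) * ((1 - B ω) * f ω - (1 + B ω) * f (S ω))
          + ∑ ω, (1 + n ω) * ((1 - B (S ω)) * f (S ω) - (1 + B (S ω)) * f ω)) := by
      rw [← Finset.sum_add_distrib, Finset.mul_sum]
      refine Finset.sum_congr rfl fun ω _ => ?_
      simp only [hw, ht, hμapp, hxapp]; ring
    rw [h3, ← h2]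
    linarith
  -- the quadratic form estimates
  set y : Ω → ℝ := x - z with hy
  set p : Ω → ℝ := x + z with hp
  set g : Ω → ℝ := fun ω => μ ω + n ω with hg
  set h : Ω → ℝ := μ - n with hh
  have hTy : ∀ ω, T y ω + 4 * y ω = t ω * g ω := fun ω => by
    have h1 := hTx ω
    have h2 := hz ω
    simp only [hy, map_sub, Pi.sub_apply, hg]
    linear_combination h1 - h2
  have hTh : ∀ ω, T h ω + 2 * h ω = w ω * g ω := fun ω => by
    have h1 := hTμ ω
    have h2 := hn ω
    simp only [hh, map_sub, Pi.sub_apply, hg]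
    linear_combination h1 - h2
  have hpol : ∑ ω, x ω * (w ω - t ω * n ω) = 1 / 4 * (∑ ω, p ω * (T p ω + 4 * p ω))
      - 1 / 4 * ∑ ω, y ω * (T y ω + 4 * y ω) := by
    have h1 : ∑ ω, p ω * (T p ω + 4 * p ω) - ∑ ω, y ω * (T y ω + 4 * y ω)
        = 2 * ∑ ω, x ω * T z ω + 2 * ∑ ω, z ω * T x ω + 16 * ∑ ω, x ω * z ω := by
      simp only [Finset.mul_sum]
      rw [← Finset.sum_sub_distrib, ← Finset.sum_add_distrib, ← Finset.sum_add_distrib]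
      refine Finset.sum_congr rfl fun ω _ => ?_
      simp only [hp, hy, map_add, map_sub, Pi.add_apply, Pi.sub_apply]
      ring
    rw [hTsym z x] at h1
    have h2 : ∑ ω, x ω * (w ω - t ω * n ω) = ∑ ω, x ω * T z ω + 4 * ∑ ω, x ω * z ω := by
      rw [Finset.mul_sum, ← Finset.sum_add_distrib]
      refine Finset.sum_congr rfl fun ω _ => ?_
      rw [← hz]; ring
    rw [h2]
    linarith
  have hPpos : 0 ≤ ∑ ω, p ω * (T p ω + 4 * p ω) := by
    have h1 : ∑ ω, p ω * (T p ω + 4 * p ω) = ∑ ω, p ω * T p ω + ∑ ω, 4 * p ω ^ 2 := by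
      rw [← Finset.sum_add_distrib]
      exact Finset.sum_congr rfl fun ω _ => by ring
    rw [h1]
    exact add_nonneg (hTpos p) (Finset.sum_nonneg fun ω _ => by positivity)
  have hY : ∑ ω, y ω * (T y ω + 4 * y ω) ≤ 1 / 4 * ∑ ω, t ω ^ 2 * g ω ^ 2 := by
    have h1 : ∑ ω, y ω * (T y ω + 4 * y ω) = ∑ ω, y ω * T y ω + 4 * ∑ ω, y ω ^ 2 := by
      rw [Finset.mul_sum, ← Finset.sum_add_distrib]
      exact Finset.sum_congr rfl fun ω _ => by ring
    -- Young's inequality, weighted so that the y² term is at most half of the left side and can be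
    -- absorbed. The estimate of `h` works in the same way.
    have h2 : ∑ ω, y ω * (T y ω + 4 * y ω)
        ≤ 2 * ∑ ω, y ω ^ 2 + 1 / 8 * ∑ ω, t ω ^ 2 * g ω ^ 2 := by
      rw [Finset.mul_sum, Finset.mul_sum, ← Finset.sum_add_distrib]
      refine Finset.sum_le_sum fun ω _ => ?_
      rw [hTy]
      nlinarith [sq_nonneg (4 * y ω - t ω * g ω)]
    have := hTpos y
    linarith
  have hH : ∑ ω, h ω ^ 2 ≤ 1 / 4 * ∑ ω, w ω ^ 2 * g ω ^ 2 := by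
    have h1 : ∑ ω, h ω * (T h ω + 2 * h ω) = ∑ ω, h ω * T h ω + 2 * ∑ ω, h ω ^ 2 := by
      rw [Finset.mul_sum, ← Finset.sum_add_distrib]
      exact Finset.sum_congr rfl fun ω _ => by ring
    have h2 : ∑ ω, h ω * (T h ω + 2 * h ω)
        ≤ ∑ ω, h ω ^ 2 + 1 / 4 * ∑ ω, w ω ^ 2 * g ω ^ 2 := by
      rw [Finset.mul_sum, ← Finset.sum_add_distrib]
      refine Finset.sum_le_sum fun ω _ => ?_
      rw [hTh]
      nlinarith [sq_nonneg (2 * h ω - w ω * g ω)]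
    have := hTpos h
    linarith
  have hnm : ∑ ω, 2 * (n ω * μ ω) = 1 / 2 * ∑ ω, g ω ^ 2 - 1 / 2 * ∑ ω, h ω ^ 2 := by
    rw [Finset.mul_sum, Finset.mul_sum, ← Finset.sum_sub_distrib]
    refine Finset.sum_congr rfl fun ω _ => ?_
    simp only [hg, hh, Pi.sub_apply]; ring
  have hfin : 1 / 8 * ∑ ω, w ω ^ 2 * g ω ^ 2 + 1 / 16 * ∑ ω, t ω ^ 2 * g ω ^ 2
      ≤ 1 / 2 * ∑ ω, g ω ^ 2 := by
    simp only [Finset.mul_sum]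
    rw [← Finset.sum_add_distrib]
    refine Finset.sum_le_sum fun ω _ => ?_
    have h1 : B ω ^ 2 < 1 := (sq_lt_one_iff_abs_lt_one _).2 (hB ω)
    have h2 : B (S ω) ^ 2 < 1 := (sq_lt_one_iff_abs_lt_one _).2 (hB (S ω))
    -- Here w² + t² = 2B² + 2(B∘S)² < 4, so 1/8 in front of both squares would still do.
    have h3 : 1 / 8 * w ω ^ 2 + 1 / 16 * t ω ^ 2 ≤ 1 / 2 := by
      simp only [hw, ht]
      nlinarith [sq_nonneg (B ω - B (S ω))]
    have := mul_le_mul_of_nonneg_right h3 (sq_nonneg (g ω))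
    linarith
  rw [Finset.sum_add_distrib, hpol, hnm] at hc
  have hcard : (0 : ℝ) < Fintype.card Ω := Nat.cast_pos.2 Fintype.card_pos
  have hcpos : 0 ≤ c * Fintype.card Ω := by linarith
  exact nonneg_of_mul_nonneg_left hcpos hcard

end TwoRow

/-! ### Upper bounds for period two and for dimension one -/

section Bounds

variable {d : ℕ} {L : Fin d → ℕ} [∀ i, NeZero (L i)]

theorem sum_comp_add (F : Torus L → ℝ) (v : Torus L) : ∑ ω, F (ω + v) = ∑ ω, F ω :=
  Equiv.sum_comp (Equiv.addRight v) F

theorem sum_comp_sub (F : Torus L → ℝ) (v : Torus L) : ∑ ω, F (ω - v) = ∑ ω, F ω :=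
  Equiv.sum_comp (Equiv.subRight v) F

variable [NeZero d] {b : Torus L → ℝ}

theorem sum_sum_neighbours (G : Torus L → ℝ) : ∑ ω, ∑ i : Fin d,
    1 / (2 * (d : ℝ)) * (G (ω + unitVec L i) + G (ω - unitVec L i)) = ∑ ω, G ω := by
  rw [Finset.sum_comm, ← sum_inv_two_mul_dim (d := d) (∑ ω, G ω)]
  refine Finset.sum_congr rfl fun i _ => ?_
  rw [← Finset.mul_sum, Finset.sum_add_distrib, sum_comp_add, sum_comp_sub,
    two_mul (∑ ω, G ω)]

/-- The symmetric part of the walk preserves the uniform measure, so only the drift contributes. -/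
theorem sum_cellOp (χ : Torus L → ℝ) :
    ∑ ω, cellOp L b χ ω = - ∑ ω, b ω * (χ (ω + unitVec L 0) - χ (ω - unitVec L 0)) := by
  simp only [cellOp_apply]
  rw [Finset.sum_sub_distrib, Finset.sum_sub_distrib, sum_sum_neighbours, sub_self, zero_sub]

/-- With period two both unit steps along e₁ are the reflection, so the drift drops out of A.
Summing the equation for χ₀ shows that 1/(2d) - q is the mean of ψ A ψ, a Dirichlet form of the
symmetric walk. -/
theorem IsCorrector.le_of_period_two {q : ℝ} {ψ : Torus L → ℝ} {χ : Fin d → Torus L → ℝ}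
    (h : IsCorrector L b q ψ χ) (hL : L 0 = 2) : q ≤ 1 / (2 * (d : ℝ)) := by
  have h2 : (2 : ZMod (L 0)) = 0 := by
    have := (ZMod.natCast_eq_zero_iff 2 (L 0)).2 (by rw [hL])
    exact_mod_cast this
  have hadd : ∀ ω : Torus L, ω + unitVec L 0 = reflect L ω := by
    intro ω
    funext j
    rcases eq_or_ne j 0 with rfl | hj
    · rw [reflect_apply_zero, Pi.add_apply, unitVec_same]
      linear_combination (1 + ω 0) * h2
    · rw [reflect_apply_ne _ hj, Pi.add_apply, unitVec_ne hj, add_zero]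
  have hsub : ∀ ω : Torus L, ω - unitVec L 0 = reflect L ω := by
    intro ω
    funext j
    rcases eq_or_ne j 0 with rfl | hj
    · rw [reflect_apply_zero, Pi.sub_apply, unitVec_same]
      linear_combination (ω 0) * h2
    · rw [reflect_apply_ne _ hj, Pi.sub_apply, unitVec_ne hj, sub_zero]
  have hsum := sum_cellOp (b := b) (χ 0)
  simp only [h.second, if_true, hadd, hsub, sub_self, mul_zero, Finset.sum_const_zero, neg_zero,
    driftOp_zero, zero_add, h.antisymm] at hsum
  have hterm : ∀ ω, b ω * (-ψ ω + -ψ ω) + (1 / (2 * (d : ℝ)) - q)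
      = (1 / (2 * (d : ℝ)) - q) - ψ ω * cellOp L b ψ ω := fun ω => by
    rw [h.first]; ring
  simp only [hterm] at hsum
  rw [Finset.sum_sub_distrib, Finset.sum_const, nsmul_eq_mul] at hsum
  have hpos : 0 ≤ ∑ ω, ψ ω * cellOp L b ψ ω := by
    have h3 : ∀ ω, ψ ω ^ 2 - ∑ i : Fin d, 1 / (2 * (d : ℝ)) * (1 / 2 *
        (2 * ψ ω ^ 2 + (ψ (ω + unitVec L i) ^ 2 + ψ (ω - unitVec L i) ^ 2)))
        ≤ ψ ω * cellOp L b ψ ω := by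
      intro ω
      rw [cellOp_apply, hadd, hsub, sub_self, mul_zero, sub_zero, mul_sub, Finset.mul_sum, ← sq]
      refine sub_le_sub_left (Finset.sum_le_sum fun i _ => ?_) _
      have hd : 0 ≤ 1 / (2 * (d : ℝ)) := by positivity
      have h4 : ψ ω * (ψ (ω + unitVec L i) + ψ (ω - unitVec L i)) ≤ 1 / 2 *
        (2 * ψ ω ^ 2 + (ψ (ω + unitVec L i) ^ 2 + ψ (ω - unitVec L i) ^ 2)) := by
        nlinarith [sq_nonneg (ψ ω - ψ (ω + unitVec L i)), sq_nonneg (ψ ω - ψ (ω - unitVec L i))]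
      have := mul_le_mul_of_nonneg_left h4 hd
      linarith
    refine le_trans (le_of_eq ?_) (Finset.sum_le_sum fun ω _ => h3 ω)
    have h5 : ∀ ω, ∑ i : Fin d, 1 / (2 * (d : ℝ)) * (1 / 2 *
        (2 * ψ ω ^ 2 + (ψ (ω + unitVec L i) ^ 2 + ψ (ω - unitVec L i) ^ 2)))
        = 1 / 2 * ψ ω ^ 2 + 1 / 2 * ∑ i : Fin d, 1 / (2 * (d : ℝ)) *
          (ψ (ω + unitVec L i) ^ 2 + ψ (ω - unitVec L i) ^ 2) := by
      intro ω
      nth_rw 2 [← sum_inv_two_mul_dim (d := d) (ψ ω ^ 2)]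
      rw [← mul_add, ← Finset.sum_add_distrib, Finset.mul_sum]
      exact Finset.sum_congr rfl fun i _ => by ring
    simp only [h5]
    rw [Finset.sum_sub_distrib, Finset.sum_add_distrib, ← Finset.mul_sum, ← Finset.mul_sum,
      sum_sum_neighbours (fun ω => ψ ω ^ 2)]
    ring
  have hcard : (0 : ℝ) < (Finset.univ : Finset (Torus L)).card := by
    rw [Finset.card_univ]; exact Nat.cast_pos.2 Fintype.card_pos
  have h6 : 0 ≤ (Finset.univ : Finset (Torus L)).card * (1 / (2 * (d : ℝ)) - q) := by linarith
  have h7 := nonneg_of_mul_nonneg_right h6 hcard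
  linarith

/-- The gradient g of x₁ + ψ obeys a first-order recursion with positive coefficients and has mean
1, so g > 0. The reversible density is 1/g(ω) + 1/g(ω - e₁), and averaging the energy against it
gives q = N / (2 ∑ 1/g) with N = |Ω|, where ∑ 1/g ≥ N. -/
theorem IsCorrector.le_of_dim_one {q : ℝ} {ψ : Torus L → ℝ} {χ : Fin d → Torus L → ℝ}
    (hb : IsAdmissible L b) (h : IsCorrector L b q ψ χ) (hd : d = 1) : q ≤ 1 / 2 := by
  have hsub : Subsingleton (Fin d) := by subst hd; infer_instance
  have hd2 : 1 / (2 * (d : ℝ)) = 1 / 2 := by rw [hd]; norm_num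
  have hcell : ∀ (F : Torus L → ℝ) ω, cellOp L b F ω
      = (1 / 2 + b ω) * (F ω - F (ω + unitVec L 0))
        + (1 / 2 - b ω) * (F ω - F (ω - unitVec L 0)) := by
    intro F ω
    rw [cellOp_eq_sum_sub, Fintype.sum_subsingleton _ 0, hd2]
    simp
  set g : Torus L → ℝ := fun ω => 1 + ψ (ω + unitVec L 0) - ψ ω with hg
  have hflux : ∀ ω, (1 / 2 + b ω) * g ω = (1 / 2 - b ω) * g (ω - unitVec L 0) := by
    intro ω
    have h1 := h.first ω
    rw [hcell] at h1
    simp only [hg, sub_add_cancel]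
    linarith
  have hbpos : ∀ ω, 0 < 1 / 2 + b ω ∧ 0 < 1 / 2 - b ω := by
    intro ω
    have h1 := abs_lt.1 (hb.abs_lt ω)
    rw [hd2] at h1
    constructor <;> linarith
  have hsumg : ∑ ω, g ω = Fintype.card (Torus L) := by
    simp only [hg]
    rw [Finset.sum_sub_distrib, Finset.sum_add_distrib, sum_comp_add]
    simp
  have hcard : (0 : ℝ) < Fintype.card (Torus L) := Nat.cast_pos.2 Fintype.card_pos
  have hgpos : ∀ ω, 0 < g ω := by
    obtain ⟨ω₀, h₀⟩ : ∃ ω, 0 < g ω := by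
      by_contra! hneg
      have := Finset.sum_nonpos fun ω (_ : ω ∈ Finset.univ) => hneg ω
      linarith
    refine forall_of_closed_add_unitVec h₀ fun i ω hω => ?_
    rw [Subsingleton.elim i 0]
    have h1 := hflux (ω + unitVec L 0)
    rw [add_sub_cancel_right] at h1
    have h2 := hbpos (ω + unitVec L 0)
    have h3 := mul_pos h2.2 hω
    rw [← h1] at h3
    exact pos_of_mul_pos_right h3 h2.1.le
  set φ : Torus L → ℝ := fun ω => (g ω)⁻¹ + (g (ω - unitVec L 0))⁻¹ with hφ
  have hφp : ∀ ω, φ ω * (1 / 2 + b ω) = (g ω)⁻¹ ∧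
      φ ω * (1 / 2 - b ω) = (g (ω - unitVec L 0))⁻¹ := by
    intro ω
    have h1 := (hgpos ω).ne'
    have h2 := (hgpos (ω - unitVec L 0)).ne'
    have h3 := hflux ω
    simp only [hφ]
    constructor
    · field_simp
      linear_combination 2 * h3
    · field_simp
      linear_combination -2 * h3
  have henergy : ∀ ω, energyDensity L b ψ ω
      = 1 / 2 * ((1 / 2 + b ω) * g ω ^ 2 + (1 / 2 - b ω) * g (ω - unitVec L 0) ^ 2) := by
    intro ω
    rw [energyDensity, Fintype.sum_subsingleton _ 0, hd2]
    simp only [if_true, hg, sub_add_cancel]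
    ring
  set F : Torus L → ℝ := χ 0 - fun ω => 1 / 2 * ψ ω ^ 2 with hF
  have hinv : ∑ ω, φ ω * cellOp L b F ω = 0 := by
    have h1 : ∀ ω, φ ω * cellOp L b F ω = (g ω)⁻¹ * (F ω - F (ω + unitVec L 0))
        - (g (ω - unitVec L 0))⁻¹ * (F (ω - unitVec L 0)
          - F (ω - unitVec L 0 + unitVec L 0)) := by
      intro ω
      rw [hcell, sub_add_cancel, ← (hφp ω).1, ← (hφp ω).2]
      ring
    rw [Finset.sum_congr rfl fun ω _ => h1 ω, Finset.sum_sub_distrib,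
      sum_comp_sub (fun ω => (g ω)⁻¹ * (F ω - F (ω + unitVec L 0))), sub_self]
  have hterm : ∀ ω, φ ω * cellOp L b F ω = 1 / 2 * (g ω + g (ω - unitVec L 0)) - q * φ ω := by
    intro ω
    rw [hF, h.cellOp_sub_half_sq, henergy]
    have h1 := (hgpos ω).ne'
    have h2 := (hgpos (ω - unitVec L 0)).ne'
    obtain ⟨h3, h4⟩ := hφp ω
    have h5 : φ ω * (1 / 2 + b ω) * g ω = 1 := by rw [h3, inv_mul_cancel₀ h1]
    have h6 : φ ω * (1 / 2 - b ω) * g (ω - unitVec L 0) = 1 := by rw [h4, inv_mul_cancel₀ h2]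
    linear_combination 1 / 2 * g ω * h5 + 1 / 2 * g (ω - unitVec L 0) * h6
  simp only [hterm] at hinv
  rw [Finset.sum_sub_distrib, ← Finset.mul_sum, ← Finset.mul_sum, Finset.sum_add_distrib,
    sum_comp_sub, hsumg] at hinv
  have hφsum : ∑ ω, φ ω = 2 * ∑ ω, (g ω)⁻¹ := by
    simp only [hφ]
    rw [Finset.sum_add_distrib, sum_comp_sub (fun ω => (g ω)⁻¹), two_mul]
  have hinvge : (Fintype.card (Torus L) : ℝ) ≤ ∑ ω, (g ω)⁻¹ := by
    -- The tangent line of 1/g at the mean value g = 1.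
    have h1 : ∀ ω, 2 - g ω ≤ (g ω)⁻¹ := fun ω => by
      rw [← sub_nonneg]
      have h2 := hgpos ω
      have h3 : (g ω)⁻¹ - (2 - g ω) = (g ω - 1) ^ 2 / g ω := by
        field_simp; ring
      rw [h3]; positivity
    have h2 := Finset.sum_le_sum fun ω (_ : ω ∈ Finset.univ) => h1 ω
    rw [Finset.sum_sub_distrib, hsumg, Finset.sum_const, Finset.card_univ, nsmul_eq_mul] at h2
    linarith
  have hq := h.pos hb
  rw [hφsum] at hinv
  by_contra! hlt
  nlinarith

end Bounds

/-! ### Period four: reduction to two rows -/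

section PeriodFour

/-- Doubling detects parity in ℤ/4: 2k is 0 for even k and 2 for odd k. -/
theorem two_mul_eq_zero_or_two {n : ℕ} (hn : n = 4) :
    (∀ k : ZMod n, 2 * k = 0 ∨ 2 * k = 2) ∧ (2 : ZMod n) ≠ 0 ∧ (4 : ZMod n) = 0 := by
  subst hn
  decide

variable {d : ℕ} {L : Fin d → ℕ} [NeZero d]

/-- The Laplacian in the directions transversal to `e₁`, with nonnegative sign. -/
noncomputable def transOp (L : Fin d → ℕ) : (Torus L → ℝ) →ₗ[ℝ] (Torus L → ℝ) where
  toFun F ω := ∑ i ∈ Finset.univ.erase (0 : Fin d),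
    (2 * F ω - F (ω + unitVec L i) - F (ω - unitVec L i))
  map_add' F G := by
    funext ω
    simp only [Pi.add_apply]
    rw [← Finset.sum_add_distrib]
    exact Finset.sum_congr rfl fun i _ => by ring
  map_smul' c F := by
    funext ω
    simp only [Pi.smul_apply, smul_eq_mul, RingHom.id_apply, Finset.mul_sum]
    exact Finset.sum_congr rfl fun i _ => by ring

theorem transOp_apply (F : Torus L → ℝ) (ω : Torus L) :
    transOp L F ω = ∑ i ∈ Finset.univ.erase (0 : Fin d),
      (2 * F ω - F (ω + unitVec L i) - F (ω - unitVec L i)) := rfl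

theorem mul_cellOp_eq (b χ : Torus L → ℝ) (ω : Torus L) :
    2 * (d : ℝ) * cellOp L b χ ω = transOp L χ ω + 2 * χ ω
      - (1 + 2 * d * b ω) * χ (ω + unitVec L 0) - (1 - 2 * d * b ω) * χ (ω - unitVec L 0) := by
  have hd : (d : ℝ) ≠ 0 := Nat.cast_ne_zero.2 (NeZero.ne d)
  rw [cellOp_eq_sum_sub, ← Finset.add_sum_erase _ _ (Finset.mem_univ (0 : Fin d)), mul_add,
    Finset.mul_sum, transOp_apply]
  have h : ∀ i ∈ Finset.univ.erase (0 : Fin d), 2 * (d : ℝ) *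
      ((1 / (2 * (d : ℝ)) + if i = 0 then b ω else 0) * (χ ω - χ (ω + unitVec L i))
      + (1 / (2 * (d : ℝ)) - if i = 0 then b ω else 0) * (χ ω - χ (ω - unitVec L i)))
      = 2 * χ ω - χ (ω + unitVec L i) - χ (ω - unitVec L i) := by
    intro i hi
    rw [if_neg (Finset.ne_of_mem_erase hi)]
    field_simp
    ring
  rw [Finset.sum_congr rfl h]
  simp only [if_true]
  field_simp
  ring

theorem transOp_comp {S : Torus L → Torus L}
    (hS : ∀ i ≠ 0, ∀ ω, S (ω + unitVec L i) = S ω + unitVec L i) (F : Torus L → ℝ) (ω : Torus L) :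
    transOp L (fun ω => F (S ω)) ω = transOp L F (S ω) := by
  rw [transOp_apply, transOp_apply]
  refine Finset.sum_congr rfl fun i hi => ?_
  have h := hS i (Finset.ne_of_mem_erase hi)
  have h2 : S (ω - unitVec L i) = S ω - unitVec L i := by
    have := h (ω - unitVec L i)
    rw [sub_add_cancel] at this
    rw [this, add_sub_cancel_right]
  rw [h, h2]

theorem transOp_mul {s : Torus L → ℝ} (hs : ∀ i ≠ 0, ∀ ω, s (ω + unitVec L i) = s ω)
    (F : Torus L → ℝ) (ω : Torus L) :
    transOp L (fun ω => s ω * F ω) ω = s ω * transOp L F ω := by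
  rw [transOp_apply, transOp_apply, Finset.mul_sum]
  refine Finset.sum_congr rfl fun i hi => ?_
  have h := hs i (Finset.ne_of_mem_erase hi)
  have h2 : s (ω - unitVec L i) = s ω := by
    have := h (ω - unitVec L i)
    rw [sub_add_cancel] at this
    exact this.symm
  rw [h, h2]
  ring

variable [∀ i, NeZero (L i)]

theorem sum_transOp (F : Torus L → ℝ) : ∑ ω, transOp L F ω = 0 := by
  simp only [transOp_apply]
  rw [Finset.sum_comm]
  refine Finset.sum_eq_zero fun i _ => ?_
  rw [Finset.sum_sub_distrib, Finset.sum_sub_distrib, sum_comp_add, sum_comp_sub,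
    ← Finset.mul_sum]
  ring

theorem sum_mul_transOp_comm (F G : Torus L → ℝ) :
    ∑ ω, F ω * transOp L G ω = ∑ ω, G ω * transOp L F ω := by
  simp only [transOp_apply, Finset.mul_sum]
  rw [Finset.sum_comm, Finset.sum_comm (γ := Torus L)]
  refine Finset.sum_congr rfl fun i _ => ?_
  have h1 : ∑ ω, F ω * G (ω + unitVec L i) = ∑ ω, G ω * F (ω - unitVec L i) := by
    rw [← sum_comp_sub (fun ω => F ω * G (ω + unitVec L i)) (unitVec L i)]
    exact Finset.sum_congr rfl fun ω _ => by rw [sub_add_cancel]; ring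
  have h2 : ∑ ω, F ω * G (ω - unitVec L i) = ∑ ω, G ω * F (ω + unitVec L i) := by
    rw [← sum_comp_add (fun ω => F ω * G (ω - unitVec L i)) (unitVec L i)]
    exact Finset.sum_congr rfl fun ω _ => by rw [add_sub_cancel_right]; ring
  simp only [mul_sub, Finset.sum_sub_distrib]
  rw [h1, h2, Finset.sum_congr rfl fun ω _ => mul_left_comm (F ω) 2 (G ω),
    Finset.sum_congr rfl fun ω _ => mul_left_comm (G ω) 2 (F ω),
    Finset.sum_congr rfl fun ω _ => congrArg (2 * ·) (mul_comm (F ω) (G ω))]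
  ring

theorem sum_mul_transOp_nonneg (F : Torus L → ℝ) : 0 ≤ ∑ ω, F ω * transOp L F ω := by
  simp only [transOp_apply, Finset.mul_sum]
  rw [Finset.sum_comm]
  refine Finset.sum_nonneg fun i _ => ?_
  have h2 : ∑ ω, F ω * F (ω - unitVec L i) = ∑ ω, F ω * F (ω + unitVec L i) := by
    rw [← sum_comp_add (fun ω => F ω * F (ω - unitVec L i)) (unitVec L i)]
    exact Finset.sum_congr rfl fun ω _ => by rw [add_sub_cancel_right]; ring
  have h3 := sum_comp_add (fun ω => F ω ^ 2) (unitVec L i)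
  have h4 : ∑ ω, F ω * (2 * F ω - F (ω + unitVec L i) - F (ω - unitVec L i))
      = ∑ ω, (F ω - F (ω + unitVec L i)) ^ 2 := by
    have h5 : ∀ ω, F ω * (2 * F ω - F (ω + unitVec L i) - F (ω - unitVec L i))
        = (F ω - F (ω + unitVec L i)) ^ 2 + (F ω ^ 2 - F (ω + unitVec L i) ^ 2)
          + (F ω * F (ω + unitVec L i) - F ω * F (ω - unitVec L i)) := fun ω => by ring
    rw [Finset.sum_congr rfl fun ω _ => h5 ω, Finset.sum_add_distrib, Finset.sum_add_distrib,
      Finset.sum_sub_distrib, Finset.sum_sub_distrib, h2, h3]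
    ring
  rw [h4]
  exact Finset.sum_nonneg fun ω _ => sq_nonneg _

/-- On the 4-cycle the reflection pairs 3 with 0 and 1 with 2, while `S` pairs 0 with 1 and 2 with
3, so the neighbours along e₁ are `S ω` and `reflect L ω`. Antisymmetry of ψ and symmetrisation of
χ₀ eliminate the reflected values. The parity sign `σ` compensates for `S` being +e₁ on even points
and -e₁ on odd ones. -/
theorem IsCorrector.le_of_period_four {b : Torus L → ℝ} (hb : IsAdmissible L b) {q : ℝ}
    {ψ : Torus L → ℝ} {χ : Fin d → Torus L → ℝ} (h : IsCorrector L b q ψ χ) (hL : L 0 = 4) :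
    q ≤ 1 / (2 * (d : ℝ)) := by
  classical
  obtain ⟨hpar, h2ne, h4⟩ := two_mul_eq_zero_or_two hL
  have hdpos : (0 : ℝ) < d := Nat.cast_pos.2 (NeZero.pos d)
  set e := unitVec L 0 with he
  let S : Torus L → Torus L := fun ω => if 2 * ω 0 = 0 then ω + e else ω - e
  let σ : Torus L → ℝ := fun ω => if 2 * ω 0 = 0 then 1 else -1
  have hSe : ∀ ω : Torus L, 2 * ω 0 = 0 → S ω = ω + e := fun ω h => if_pos h
  have hSo : ∀ ω : Torus L, ¬ 2 * ω 0 = 0 → S ω = ω - e := fun ω h => if_neg h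
  have hσe : ∀ ω : Torus L, 2 * ω 0 = 0 → σ ω = 1 := fun ω h => if_pos h
  have hσo : ∀ ω : Torus L, ¬ 2 * ω 0 = 0 → σ ω = -1 := fun ω h => if_neg h
  have hadd : ∀ ω : Torus L, 2 * (ω + e) 0 = 2 * ω 0 + 2 := fun ω => by
    rw [Pi.add_apply, he, unitVec_same]; ring
  have hsub : ∀ ω : Torus L, 2 * (ω - e) 0 = 2 * ω 0 - 2 := fun ω => by
    rw [Pi.sub_apply, he, unitVec_same]; ring
  have hRe : ∀ ω : Torus L, 2 * ω 0 = 0 → reflect L ω = ω - e := by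
    intro ω hω
    funext j
    rcases eq_or_ne j 0 with rfl | hj
    · rw [reflect_apply_zero, Pi.sub_apply, he, unitVec_same]
      linear_combination -hω
    · rw [reflect_apply_ne _ hj, Pi.sub_apply, he, unitVec_ne hj, sub_zero]
  have hRo : ∀ ω : Torus L, ¬ 2 * ω 0 = 0 → reflect L ω = ω + e := by
    intro ω hω
    have hω' := (hpar (ω 0)).resolve_left hω
    funext j
    rcases eq_or_ne j 0 with rfl | hj
    · rw [reflect_apply_zero, Pi.add_apply, he, unitVec_same]
      linear_combination -hω' - h4
    · rw [reflect_apply_ne _ hj, Pi.add_apply, he, unitVec_ne hj, add_zero]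
  have hoadd : ∀ ω : Torus L, 2 * ω 0 = 0 → ¬ 2 * (ω + e) 0 = 0 := fun ω hω => by
    rw [hadd, hω, zero_add]; exact h2ne
  have headd : ∀ ω : Torus L, ¬ 2 * ω 0 = 0 → 2 * (ω + e) 0 = 0 := fun ω hω => by
    rw [hadd, (hpar (ω 0)).resolve_left hω]; linear_combination h4
  have hesub : ∀ ω : Torus L, ¬ 2 * ω 0 = 0 → 2 * (ω - e) 0 = 0 := fun ω hω => by
    rw [hsub, (hpar (ω 0)).resolve_left hω]; ring
  have hSS : ∀ ω, S (S ω) = ω := by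
    intro ω
    by_cases hω : 2 * ω 0 = 0
    · rw [hSe ω hω, hSo _ (hoadd ω hω), add_sub_cancel_right]
    · rw [hSo ω hω, hSe _ (hesub ω hω), sub_add_cancel]
  have hσS : ∀ ω, σ (S ω) = - σ ω := by
    intro ω
    by_cases hω : 2 * ω 0 = 0
    · rw [hSe ω hω, hσo _ (hoadd ω hω), hσe ω hω]
    · rw [hSo ω hω, hσe _ (hesub ω hω), hσo ω hω, neg_neg]
  have hσsq : ∀ ω, σ ω * σ ω = 1 := by
    intro ω
    by_cases hω : 2 * ω 0 = 0
    · rw [hσe ω hω]; norm_num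
    · rw [hσo ω hω]; norm_num
  have hpari : ∀ i ≠ (0 : Fin d), ∀ ω : Torus L, (ω + unitVec L i) 0 = ω 0 := fun i hi ω => by
    rw [Pi.add_apply, unitVec_ne hi.symm, add_zero]
  have hStrans : ∀ i ≠ (0 : Fin d), ∀ ω, S (ω + unitVec L i) = S ω + unitVec L i := by
    intro i hi ω
    by_cases hω : 2 * ω 0 = 0
    · rw [hSe ω hω, hSe _ (by rw [hpari i hi]; exact hω), add_right_comm]
    · rw [hSo ω hω, hSo _ (by rw [hpari i hi]; exact hω), sub_add_eq_add_sub]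
  have hσtrans : ∀ i ≠ (0 : Fin d), ∀ ω, σ (ω + unitVec L i) = σ ω := by
    intro i hi ω
    simp only [σ, hpari i hi]
  set B : Torus L → ℝ := fun ω => σ ω * (2 * d * b ω) with hBdef
  have hB : ∀ ω, |B ω| < 1 := by
    intro ω
    have h1 : |σ ω| = 1 := by
      by_cases hω : 2 * ω 0 = 0
      · rw [hσe ω hω, abs_one]
      · rw [hσo ω hω, abs_neg, abs_one]
    have h2 := hb.abs_lt ω
    rw [lt_div_iff₀ (by positivity)] at h2
    simp only [hBdef]
    rw [abs_mul, h1, one_mul, abs_mul, abs_of_pos (a := 2 * (d : ℝ)) (by positivity)]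
    linarith
  have hcell : ∀ (F : Torus L → ℝ) ω, 2 * (d : ℝ) * cellOp L b F ω = transOp L F ω + 2 * F ω
      - (1 + B ω) * F (S ω) - (1 - B ω) * F (reflect L ω) := by
    intro F ω
    rw [mul_cellOp_eq]
    by_cases hω : 2 * ω 0 = 0
    · simp only [hBdef]
      rw [hσe ω hω, hSe ω hω, hRe ω hω]; ring
    · simp only [hBdef]
      rw [hσo ω hω, hSo ω hω, hRo ω hω]; ring
  have hdrift : ∀ ω, 2 * (d : ℝ) * driftOp L b 0 ψ ω
      = σ ω * ((1 + B ω) * ψ (S ω) - (1 - B ω) * ψ (reflect L ω)) := by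
    intro ω
    have h1 : 2 * (d : ℝ) * driftOp L b 0 ψ ω
        = (1 + 2 * d * b ω) * ψ (ω + e) - (1 - 2 * d * b ω) * ψ (ω - e) := by
      rw [driftOp_zero]; field_simp; ring
    rw [h1]
    by_cases hω : 2 * ω 0 = 0
    · simp only [hBdef]
      rw [hσe ω hω, hSe ω hω, hRe ω hω]; ring
    · simp only [hBdef]
      rw [hσo ω hω, hSo ω hω, hRo ω hω]; ring
  set f : Torus L → ℝ := fun ω => σ ω * ψ ω with hf
  have hfS : ∀ ω, f (S ω) = - (σ ω * ψ (S ω)) := fun ω => by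
    simp only [hf, hσS]; ring
  have hfeq : ∀ ω, transOp L f ω + (3 - B ω) * f ω + (1 + B ω) * f (S ω) = 2 * B ω := by
    intro ω
    have h1 := hcell ψ ω
    rw [h.first, h.antisymm] at h1
    rw [hfS, hf, transOp_mul hσtrans]
    simp only [hBdef] at h1 ⊢
    linear_combination -σ ω * h1
  set F : Torus L → ℝ := fun ω => 1 / 2 * (χ 0 ω + χ 0 (reflect L ω)) with hF
  have hFR : ∀ ω, F (reflect L ω) = F ω := fun ω => by
    simp only [hF, reflect_reflect]; ring
  -- The datum of χ₀ is reflection-symmetric, so the symmetrised `F` solves the same equation.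
  have hdR : ∀ ω, driftOp L b 0 ψ (reflect L ω) = driftOp L b 0 ψ ω := by
    intro ω
    rw [driftOp_zero, driftOp_zero, ← reflect_sub_unitVec_zero, ← reflect_add_unitVec_zero,
      h.antisymm, h.antisymm, hb.antisymm ω]
    ring
  have hAF : ∀ ω, cellOp L b F ω = driftOp L b 0 ψ ω + (1 / (2 * (d : ℝ)) - q) := by
    intro ω
    have h1 : F = (1 / 2 : ℝ) • (χ 0 + fun ω => χ 0 (reflect L ω)) := rfl
    rw [h1, map_smul, map_add, Pi.smul_apply, Pi.add_apply, cellOp_comp_reflect hb, h.second,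
      h.second, if_pos rfl, hdR, smul_eq_mul]
    ring
  have hFeq : ∀ ω, transOp L F ω + (1 + B ω) * (F ω - F (S ω))
      = (1 - B ω) * f ω - (1 + B ω) * f (S ω) + 2 * d * (1 / (2 * (d : ℝ)) - q) := by
    intro ω
    have h1 := hcell F ω
    rw [hAF, mul_add, hdrift, hFR, h.antisymm] at h1
    rw [hfS]
    simp only [hf]
    linear_combination -h1
  have hfinal := nonneg_of_involution hSS (transOp L) sum_mul_transOp_comm sum_mul_transOp_nonneg
    sum_transOp (transOp_comp hStrans) hB hfeq hFeq
  have := nonneg_of_mul_nonneg_right hfinal (by positivity : (0 : ℝ) < 2 * d)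
  linarith

end PeriodFour

/-! ### Sine and cosine waves on a cycle -/

section Wave

variable {n : ℕ} [NeZero n]

/-- The function `x ↦ p (2πk/n x + a)` on `ℤ/n`, for a `2π`-periodic function `p`. -/
noncomputable def wave (p : ℝ → ℝ) (k : ℕ) (a : ℝ) (x : ZMod n) : ℝ :=
  p (2 * Real.pi * k / n * x.val + a)

/-- Periodicity makes the choice of representative irrelevant, so shifts and reflections can be
computed on integers. -/
theorem wave_intCast {p : ℝ → ℝ} (hp : Function.Periodic p (2 * Real.pi)) (k : ℕ) (a : ℝ) (m : ℤ) :
    wave p k a (m : ZMod n) = p (2 * Real.pi * k / n * m + a) := by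
  have hn : (n : ℝ) ≠ 0 := Nat.cast_ne_zero.2 (NeZero.ne n)
  have h1 : (((m : ZMod n).val : ℤ) : ℝ) = ((m % n : ℤ) : ℝ) := by rw [ZMod.val_intCast]
  have h2 : (m : ℝ) = ((m % n : ℤ) : ℝ) + n * ((m / n : ℤ) : ℝ) := by
    exact_mod_cast (Int.emod_add_mul_ediv m n).symm
  rw [Int.cast_natCast] at h1
  rw [wave, h1]
  have h3 := hp.int_mul ((k : ℤ) * (m / n)) (2 * Real.pi * k / n * ((m % n : ℤ) : ℝ) + a)
  rw [← h3]
  congr 1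
  rw [h2]
  push_cast
  field_simp
  ring

theorem wave_add_one {p : ℝ → ℝ} (hp : Function.Periodic p (2 * Real.pi)) (k : ℕ) (a : ℝ)
    (x : ZMod n) : wave p k a (x + 1)
      = p ((2 * Real.pi * k / n * x.val + a) + 2 * Real.pi * k / n) := by
  have h : x + 1 = (((x.val : ℤ) + 1 : ℤ) : ZMod n) := by
    push_cast
    rw [ZMod.natCast_zmod_val]
  rw [h, wave_intCast hp]
  push_cast
  ring_nf

theorem wave_sub_one {p : ℝ → ℝ} (hp : Function.Periodic p (2 * Real.pi)) (k : ℕ) (a : ℝ)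
    (x : ZMod n) : wave p k a (x - 1)
      = p ((2 * Real.pi * k / n * x.val + a) - 2 * Real.pi * k / n) := by
  have h : x - 1 = (((x.val : ℤ) - 1 : ℤ) : ZMod n) := by
    push_cast
    rw [ZMod.natCast_zmod_val]
  rw [h, wave_intCast hp]
  push_cast
  ring_nf

theorem wave_sin_add_sub (k : ℕ) (a : ℝ) (x : ZMod n) :
    wave Real.sin k a (x + 1) + wave Real.sin k a (x - 1)
      = 2 * Real.cos (2 * Real.pi * k / n) * wave Real.sin k a x := by
  rw [wave_add_one Real.sin_periodic, wave_sub_one Real.sin_periodic, wave, Real.sin_add,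
    Real.sin_sub]
  ring

theorem wave_cos_add_sub (k : ℕ) (a : ℝ) (x : ZMod n) :
    wave Real.cos k a (x + 1) + wave Real.cos k a (x - 1)
      = 2 * Real.cos (2 * Real.pi * k / n) * wave Real.cos k a x := by
  rw [wave_add_one Real.cos_periodic, wave_sub_one Real.cos_periodic, wave, Real.cos_add,
    Real.cos_sub]
  ring

/-- The phase π/n centres the sine at x = -1/2, the fixed point of x ↦ -1 - x. -/
theorem wave_sin_reflect (x : ZMod n) :
    wave Real.sin 1 (Real.pi / n) (-1 - x) = - wave Real.sin 1 (Real.pi / n) x := by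
  have h : -1 - x = ((-1 - (x.val : ℤ) : ℤ) : ZMod n) := by
    push_cast
    rw [ZMod.natCast_zmod_val]
  rw [h, wave_intCast Real.sin_periodic, wave, ← Real.sin_neg]
  congr 1
  push_cast
  ring

end Wave

/-! ### Small plane-wave drifts that increase the coefficient -/

section Perturbation

variable {d : ℕ} [NeZero d] {L : Fin d → ℕ}

/-- The derivative of `-cellOp` in the direction `β` of the drift. -/
noncomputable def diffOp (L : Fin d → ℕ) (β : Torus L → ℝ) :
    (Torus L → ℝ) →ₗ[ℝ] (Torus L → ℝ) where
  toFun F ω := β ω * (F (ω + unitVec L 0) - F (ω - unitVec L 0))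
  map_add' F G := by
    funext ω; simp only [Pi.add_apply]; ring
  map_smul' c F := by
    funext ω; simp only [Pi.smul_apply, smul_eq_mul, RingHom.id_apply]; ring

/-- The derivative of `driftOp` in the direction `β` of the drift. -/
noncomputable def meanOp (L : Fin d → ℕ) (β : Torus L → ℝ) :
    (Torus L → ℝ) →ₗ[ℝ] (Torus L → ℝ) where
  toFun F ω := β ω * (F (ω + unitVec L 0) + F (ω - unitVec L 0))
  map_add' F G := by
    funext ω; simp only [Pi.add_apply]; ring
  map_smul' c F := by
    funext ω; simp only [Pi.smul_apply, smul_eq_mul, RingHom.id_apply]; ring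

theorem diffOp_apply (β F : Torus L → ℝ) (ω : Torus L) :
    diffOp L β F ω = β ω * (F (ω + unitVec L 0) - F (ω - unitVec L 0)) := rfl

theorem meanOp_apply (β F : Torus L → ℝ) (ω : Torus L) :
    meanOp L β F ω = β ω * (F (ω + unitVec L 0) + F (ω - unitVec L 0)) := rfl

theorem driftOp_smul_eq (η : ℝ) (β F : Torus L → ℝ) :
    driftOp L (η • β) 0 F = diffOp L (fun _ => 1 / (2 * (d : ℝ))) F + η • meanOp L β F := by
  funext ω
  rw [driftOp_zero, Pi.add_apply, Pi.smul_apply, Pi.smul_apply, diffOp_apply, meanOp_apply,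
    smul_eq_mul, smul_eq_mul]
  ring

/-- The eigenvalue equations of a plane wave in the directions `e₁` and `e_j`. -/
structure IsPlaneWave (L : Fin d → ℕ) (j : Fin d) (κ ς : ℝ) (F : Torus L → ℝ) : Prop where
  first : ∀ ω, F (ω + unitVec L 0) + F (ω - unitVec L 0) = 2 * κ * F ω
  second : ∀ ω, F (ω + unitVec L j) + F (ω - unitVec L j) = 2 * ς * F ω
  other : ∀ i, i ≠ 0 → i ≠ j → ∀ ω, F (ω + unitVec L i) + F (ω - unitVec L i) = 2 * F ω

theorem IsPlaneWave.diffOp_const {j : Fin d} {κ ς : ℝ} {F : Torus L → ℝ}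
    (h : IsPlaneWave L j κ ς F) (c : ℝ) : IsPlaneWave L j κ ς (diffOp L (fun _ => c) F) := by
  have key : ∀ (v ω : Torus L) (r : ℝ), (∀ ω, F (ω + v) + F (ω - v) = r * F ω) →
      diffOp L (fun _ => c) F (ω + v) + diffOp L (fun _ => c) F (ω - v)
        = r * diffOp L (fun _ => c) F ω := by
    intro v ω r hr
    have h1 := hr (ω + unitVec L 0)
    have h2 := hr (ω - unitVec L 0)
    simp only [diffOp_apply]
    rw [add_right_comm ω v, sub_add_eq_add_sub ω v, add_sub_right_comm ω v, sub_right_comm ω v]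
    linear_combination c * h1 - c * h2
  exact ⟨fun ω => key _ _ _ h.first, fun ω => key _ _ _ h.second,
    fun i hi hij ω => key _ _ _ (h.other i hi hij)⟩

variable [∀ i, NeZero (L i)]

theorem regOp_smul_eq (η : ℝ) (β : Torus L → ℝ) :
    regOp L (η • β) = regOp L 0 - η • diffOp L β := by
  refine LinearMap.ext fun F => funext fun ω => ?_
  simp only [LinearMap.sub_apply, LinearMap.smul_apply, Pi.sub_apply, Pi.smul_apply, smul_eq_mul,
    regOp_apply, cellOp_apply, diffOp_apply, Pi.zero_apply]
  ring

/-- The regularised generator as a bounded operator. -/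
noncomputable def regCLM (L : Fin d → ℕ) [∀ i, NeZero (L i)] (b : Torus L → ℝ) :
    (Torus L → ℝ) →L[ℝ] (Torus L → ℝ) :=
  LinearMap.toContinuousLinearMap (regOp L b)

theorem isUnit_regCLM {b : Torus L → ℝ} (hb : ∀ ω, |b ω| < 1 / (2 * (d : ℝ))) :
    IsUnit (regCLM L b) := by
  rw [ContinuousLinearMap.isUnit_iff_bijective]
  have := regOp_injective hb
  exact ⟨this, LinearMap.injective_iff_surjective.1 this⟩

theorem inverse_regCLM_apply {b : Torus L → ℝ} (hb : ∀ ω, |b ω| < 1 / (2 * (d : ℝ)))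
    {F G : Torus L → ℝ} (h : regOp L b F = G) : Ring.inverse (regCLM L b) G = F := by
  have h1 := Ring.inverse_mul_cancel _ (isUnit_regCLM hb)
  have h2 := congrArg (fun T : (Torus L → ℝ) →L[ℝ] (Torus L → ℝ) => T F) h1
  rw [← h]
  exact h2

/-- Unlike the generator itself, the regularised one is invertible at η = 0, and inversion is
continuous at units. -/
theorem continuousAt_inverse_regCLM (β : Torus L → ℝ) :
    ContinuousAt (fun η : ℝ => Ring.inverse (regCLM L (η • β))) 0 := by
  have h0 : ∀ ω : Torus L, |((0 : ℝ) • β) ω| < 1 / (2 * (d : ℝ)) := fun ω => by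
    have : (0 : ℝ) < d := Nat.cast_pos.2 (NeZero.pos d)
    simp only [zero_smul, Pi.zero_apply, abs_zero]
    positivity
  obtain ⟨u, hu⟩ := isUnit_regCLM h0
  have h1 : ContinuousAt Ring.inverse (regCLM L ((0 : ℝ) • β)) := by
    rw [← hu]; exact NormedRing.inverse_continuousAt u
  have h2 : Continuous fun η : ℝ => regCLM L (η • β) := by
    have : (fun η : ℝ => regCLM L (η • β)) = fun η =>
        regCLM L 0 - η • LinearMap.toContinuousLinearMap (diffOp L β) := by
      funext η
      simp only [regCLM, regOp_smul_eq, map_sub, map_smul]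
    rw [this]
    fun_prop
  exact ContinuousAt.comp (f := fun η : ℝ => regCLM L (η • β)) (x := 0) h1 h2.continuousAt

theorem sum_eq_zero_of_antisymm {F : Torus L → ℝ} (hF : ∀ ω, F (reflect L ω) = - F ω) :
    ∑ ω, F ω = 0 := by
  have h : ∑ ω, F (reflect L ω) = ∑ ω, F ω :=
    Equiv.sum_comp (Function.Involutive.toPerm (reflect L) reflect_reflect) F
  simp only [hF, Finset.sum_neg_distrib] at h
  linarith

theorem sum_diffOp_const (c : ℝ) (F : Torus L → ℝ) : ∑ ω, diffOp L (fun _ => c) F ω = 0 := by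
  simp only [diffOp_apply]
  rw [← Finset.mul_sum, Finset.sum_sub_distrib, sum_comp_add, sum_comp_sub, sub_self, mul_zero]

/-- The second order coefficient in the expansion of the effective coefficient of `η β`. -/
noncomputable def secondVariation (L : Fin d → ℕ) [∀ i, NeZero (L i)] (β : Torus L → ℝ)
    (η : ℝ) : ℝ :=
  ∑ ω, meanOp L β (Ring.inverse (regCLM L (η • β)) β) ω
    + ∑ ω, diffOp L β (Ring.inverse (regCLM L (η • β))
      (driftOp L (η • β) 0 (Ring.inverse (regCLM L (η • β)) β))) ω

/-- This comes from summing the equation of χ₀ over the torus. The corrector ψ is 2η times the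
regularised inverse of β, and one more factor η comes from the drift. -/
theorem IsCorrector.card_mul_sub_eq {η : ℝ} {β : Torus L → ℝ} (hb : IsAdmissible L (η • β))
    {q : ℝ} {ψ : Torus L → ℝ} {χ : Fin d → Torus L → ℝ} (h : IsCorrector L (η • β) q ψ χ) :
    Fintype.card (Torus L) * (q - 1 / (2 * (d : ℝ))) = 2 * η ^ 2 * secondVariation L β η := by
  have hcard : (Fintype.card (Torus L) : ℝ) ≠ 0 := Nat.cast_ne_zero.2 Fintype.card_ne_zero
  set J := Ring.inverse (regCLM L (η • β)) with hJ
  have hψ : ψ = (2 * η) • J β := by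
    have h1 : regOp L (η • β) ψ = (2 * η) • β := by
      funext ω
      rw [regOp_apply, h.first, sum_eq_zero_of_antisymm h.antisymm]
      simp only [Pi.smul_apply, smul_eq_mul]
      ring
    rw [← map_smul, hJ, inverse_regCLM_apply hb.abs_lt h1]
  -- The shift that absorbs the constant 1/(2d) - q under `regOp`; it disappears in the differences
  -- taken by `diffOp`.
  set k : ℝ := (∑ ω, χ 0 ω - (q - 1 / (2 * (d : ℝ)))) / Fintype.card (Torus L) with hk
  have hχ : J (driftOp L (η • β) 0 ψ) = χ 0 - fun _ => k := by
    refine inverse_regCLM_apply hb.abs_lt (funext fun ω => ?_)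
    rw [regOp_apply, map_sub, cellOp_const, sub_zero, h.second, if_pos rfl]
    simp only [Pi.sub_apply]
    rw [Finset.sum_sub_distrib, Finset.sum_const, Finset.card_univ, nsmul_eq_mul, hk,
      mul_div_cancel₀ _ hcard]
    ring
  have hsum := sum_cellOp (b := η • β) (χ 0)
  simp only [h.second, if_true, driftOp_smul_eq, Pi.add_apply, Pi.smul_apply, smul_eq_mul] at hsum
  rw [Finset.sum_add_distrib, Finset.sum_add_distrib, sum_diffOp_const, zero_add,
    ← Finset.mul_sum, Finset.sum_const, Finset.card_univ, nsmul_eq_mul] at hsum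
  have hB : ∑ ω, η * β ω * (χ 0 (ω + unitVec L 0) - χ 0 (ω - unitVec L 0))
      = η * ∑ ω, diffOp L β (J (driftOp L (η • β) 0 ψ)) ω := by
    rw [hχ, Finset.mul_sum]
    refine Finset.sum_congr rfl fun ω _ => ?_
    rw [diffOp_apply]
    simp only [Pi.sub_apply]
    ring
  rw [hB] at hsum
  have hlin : driftOp L (η • β) 0 ψ = (2 * η) • driftOp L (η • β) 0 (J β) := by
    rw [hψ, driftOp_smul_eq, driftOp_smul_eq, map_smul, map_smul, smul_add, smul_comm η]
  rw [hlin, map_smul, map_smul, hψ, map_smul] at hsum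
  simp only [Pi.smul_apply, smul_eq_mul] at hsum
  rw [← Finset.mul_sum, ← Finset.mul_sum] at hsum
  rw [secondVariation, ← hJ]
  linear_combination -hsum

theorem continuousAt_secondVariation (β : Torus L → ℝ) :
    ContinuousAt (secondVariation L β) 0 := by
  have hJ := continuousAt_inverse_regCLM β
  have hJβ : ContinuousAt (fun η : ℝ => Ring.inverse (regCLM L (η • β)) β) 0 :=
    hJ.clm_apply continuousAt_const
  have hlin : ∀ T : (Torus L → ℝ) →ₗ[ℝ] (Torus L → ℝ), Continuous T := fun T =>
    (LinearMap.toContinuousLinearMap T).continuous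
  have hsum : Continuous fun F : Torus L → ℝ => ∑ ω, F ω := by fun_prop
  have hD : ContinuousAt (fun η : ℝ => driftOp L (η • β) 0
      (Ring.inverse (regCLM L (η • β)) β)) 0 := by
    simp only [driftOp_smul_eq]
    exact ((hlin _).continuousAt.comp hJβ).add
      (continuousAt_id.smul ((hlin _).continuousAt.comp hJβ))
  exact (hsum.continuousAt.comp ((hlin _).continuousAt.comp hJβ)).add
    (hsum.continuousAt.comp ((hlin _).continuousAt.comp (hJ.clm_apply hD)))

theorem IsPlaneWave.regOp_zero {j : Fin d} (hj : j ≠ 0) {κ ς : ℝ} {F : Torus L → ℝ}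
    (h : IsPlaneWave L j κ ς F) (hF : ∑ ω, F ω = 0) :
    regOp L 0 F = ((2 - κ - ς) / d) • F := by
  have hd : (d : ℝ) ≠ 0 := Nat.cast_ne_zero.2 (NeZero.ne d)
  funext ω
  rw [regOp_apply, hF, add_zero, cellOp_apply, Pi.zero_apply, zero_mul, sub_zero]
  have h1 : ∀ i : Fin d, 1 / (2 * (d : ℝ)) * (F (ω + unitVec L i) + F (ω - unitVec L i))
      = 1 / d * F ω - (if i = 0 then (1 - κ) / d * F ω else 0)
        - (if i = j then (1 - ς) / d * F ω else 0) := by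
    intro i
    rcases eq_or_ne i 0 with rfl | hi
    · rw [h.first, if_pos rfl, if_neg hj.symm]; field_simp; ring
    · rcases eq_or_ne i j with rfl | hij
      · rw [h.second, if_neg hi, if_pos rfl]; field_simp; ring
      · rw [h.other i hi hij, if_neg hi, if_neg hij]; field_simp; ring
  rw [Finset.sum_congr rfl fun i _ => h1 i, Finset.sum_sub_distrib, Finset.sum_sub_distrib]
  simp only [Finset.sum_const, Finset.card_univ, Fintype.card_fin, nsmul_eq_mul,
    Finset.sum_ite_eq', Finset.mem_univ, if_true, Pi.smul_apply, smul_eq_mul]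
  field_simp
  ring

theorem IsPlaneWave.secondVariation_zero_pos {j : Fin d} (hj : j ≠ 0) {κ ς : ℝ}
    {β : Torus L → ℝ} (h : IsPlaneWave L j κ ς β) (hβ : ∑ ω, β ω = 0) (hβ0 : β ≠ 0)
    (hκ : 1 / 2 ≤ κ) (hκ1 : κ ≤ 1) (hς : ς < 0) : 0 < secondVariation L β 0 := by
  have hd : (0 : ℝ) < d := Nat.cast_pos.2 (NeZero.pos d)
  set a : ℝ := (2 - κ - ς) / d with ha
  have hapos : 0 < a := by
    rw [ha]; exact div_pos (by linarith) hd
  have hadm : ∀ ω : Torus L, |(0 : Torus L → ℝ) ω| < 1 / (2 * (d : ℝ)) := fun ω => by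
    rw [Pi.zero_apply, abs_zero]; positivity
  have hinv : ∀ F : Torus L → ℝ, IsPlaneWave L j κ ς F → ∑ ω, F ω = 0 →
      Ring.inverse (regCLM L 0) F = a⁻¹ • F := by
    intro F hF hF0
    refine inverse_regCLM_apply hadm ?_
    rw [map_smul, hF.regOp_zero hj hF0, smul_smul, inv_mul_cancel₀ hapos.ne', one_smul]
  -- The central difference applied twice to a wave of cosine κ: 4(κ² - 1) = -4 sin².
  have hβ2 : ∀ ω, β (ω + unitVec L 0 + unitVec L 0) - β ω - (β ω - β (ω - unitVec L 0 - unitVec L 0))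
      = 4 * (κ ^ 2 - 1) * β ω := by
    intro ω
    have h1 := h.first (ω + unitVec L 0)
    have h2 := h.first (ω - unitVec L 0)
    have h3 := h.first ω
    rw [add_sub_cancel_right] at h1
    rw [sub_add_cancel] at h2
    linear_combination h1 + h2 + 2 * κ * h3
  have hval : secondVariation L β 0
      = (2 * κ * a⁻¹ + a⁻¹ ^ 2 * (1 / (2 * (d : ℝ))) * (4 * (κ ^ 2 - 1))) * ∑ ω, β ω ^ 2 := by
    rw [secondVariation, driftOp_smul_eq, zero_smul, zero_smul, add_zero, hinv β h hβ, map_smul,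
      map_smul, map_smul, hinv _ (h.diffOp_const _) (sum_diffOp_const _ _), map_smul, map_smul,
      add_mul, Finset.mul_sum, Finset.mul_sum]
    congr 1
    · refine Finset.sum_congr rfl fun ω _ => ?_
      rw [Pi.smul_apply, meanOp_apply, h.first, smul_eq_mul]
      ring
    · refine Finset.sum_congr rfl fun ω _ => ?_
      rw [Pi.smul_apply, Pi.smul_apply, diffOp_apply, diffOp_apply, diffOp_apply, smul_eq_mul,
        smul_eq_mul, add_sub_cancel_right, sub_add_cancel]
      linear_combination a⁻¹ ^ 2 * (1 / (2 * (d : ℝ))) * β ω * hβ2 ω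
  have hβpos : 0 < ∑ ω, β ω ^ 2 := by
    obtain ⟨ω, hω⟩ := Function.ne_iff.1 hβ0
    exact Finset.sum_pos' (fun ω _ => sq_nonneg _) ⟨ω, Finset.mem_univ _, by
      have : β ω ≠ 0 := hω
      positivity⟩
  rw [hval]
  refine mul_pos ?_ hβpos
  have h1 : 2 * κ * a⁻¹ + a⁻¹ ^ 2 * (1 / (2 * (d : ℝ))) * (4 * (κ ^ 2 - 1))
      = a⁻¹ ^ 2 * (2 / d) * (κ * (a * d) - (1 - κ ^ 2)) := by
    field_simp
    ring
  have h2 : a * d = 2 - κ - ς := by rw [ha]; field_simp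
  rw [h1, h2]
  -- The κ² terms cancel and leave (2κ - 1) - κς.
  have h3 : 0 < κ * (2 - κ - ς) - (1 - κ ^ 2) := by nlinarith
  positivity

/-- A small plane wave drift increases the effective coefficient. -/
theorem IsPlaneWave.exists_effective_gt {j : Fin d} (hj : j ≠ 0) {κ ς : ℝ}
    {β : Torus L → ℝ} (h : IsPlaneWave L j κ ς β) (hanti : ∀ ω, β (reflect L ω) = - β ω)
    (hβ1 : ∀ ω, |β ω| ≤ 1) (hβ0 : β ≠ 0) (hκ : 1 / 2 ≤ κ) (hκ1 : κ ≤ 1) (hς : ς < 0) :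
    ∃ (b : Torus L → ℝ) (q : ℝ), IsAdmissible L b ∧ IsEffectiveCoefficient L b q ∧
      1 / (2 * (d : ℝ)) < q := by
  have hd : (0 : ℝ) < d := Nat.cast_pos.2 (NeZero.pos d)
  have hpos := h.secondVariation_zero_pos hj (sum_eq_zero_of_antisymm hanti) hβ0 hκ hκ1 hς
  have hev := (continuousAt_secondVariation β).eventually (lt_mem_nhds hpos)
  have hev2 : ∀ᶠ η : ℝ in 𝓝[>] 0, 0 < secondVariation L β η ∧ 0 < η ∧ η < 1 / (2 * (d : ℝ)) := by
    filter_upwards [hev.filter_mono nhdsWithin_le_nhds,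
      Ioo_mem_nhdsGT (show (0 : ℝ) < 1 / (2 * (d : ℝ)) by positivity)] with η h1 h2
    exact ⟨h1, h2.1, h2.2⟩
  obtain ⟨η, hV, hη, hη2⟩ := hev2.exists
  have hadm : IsAdmissible L (η • β) := by
    refine ⟨fun ω => ?_, fun ω => ?_⟩
    · rw [Pi.smul_apply, smul_eq_mul, abs_mul, abs_of_pos hη]
      have := mul_le_mul_of_nonneg_left (hβ1 ω) hη.le
      linarith
    · simp only [Pi.smul_apply, smul_eq_mul, hanti]
      ring
  obtain ⟨q, ψ, χ, hc⟩ := exists_isCorrector hadm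
  refine ⟨η • β, q, hadm, hc.isEffectiveCoefficient hadm, ?_⟩
  have hcard : (0 : ℝ) < Fintype.card (Torus L) := Nat.cast_pos.2 Fintype.card_pos
  have h1 := hc.card_mul_sub_eq hadm
  have h2 : 0 < 2 * η ^ 2 * secondVariation L β η := by positivity
  rw [← h1] at h2
  exact sub_pos.1 (pos_of_mul_pos_right h2 hcard.le)

theorem exists_effective_gt (hL0 : 6 ≤ L 0) {j : Fin d} (hj : j ≠ 0) (hLj : 2 ≤ L j) :
    ∃ (b : Torus L → ℝ) (q : ℝ), IsAdmissible L b ∧ IsEffectiveCoefficient L b q ∧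
      1 / (2 * (d : ℝ)) < q := by
  -- The fastest transversal oscillation: 2πk/L_j lies in (π/2, π] as soon as L_j ≥ 2, so its cosine
  -- is negative.
  set k : ℕ := L j / 2 with hk
  have hπ := Real.pi_pos
  have hL0' : (6 : ℝ) ≤ L 0 := by exact_mod_cast hL0
  have hLj' : (2 : ℝ) ≤ L j := by exact_mod_cast hLj
  let β : Torus L → ℝ := fun ω => wave Real.sin 1 (Real.pi / L 0) (ω 0) * wave Real.cos k 0 (ω j)
  have hwave : IsPlaneWave L j (Real.cos (2 * Real.pi * (1 : ℕ) / L 0))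
      (Real.cos (2 * Real.pi * k / L j)) β := by
    refine ⟨fun ω => ?_, fun ω => ?_, fun i hi hij ω => ?_⟩
    · have h := wave_sin_add_sub 1 (Real.pi / L 0) (ω 0)
      simp only [β, Pi.add_apply, Pi.sub_apply, unitVec_same, unitVec_ne hj, add_zero, sub_zero]
      linear_combination wave Real.cos k 0 (ω j) * h
    · have h := wave_cos_add_sub k 0 (ω j)
      simp only [β, Pi.add_apply, Pi.sub_apply, unitVec_same, unitVec_ne hj.symm, add_zero,
        sub_zero]
      linear_combination wave Real.sin 1 (Real.pi / L 0) (ω 0) * h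
    · simp only [β, Pi.add_apply, Pi.sub_apply, unitVec_ne hi.symm, unitVec_ne hij.symm, add_zero,
        sub_zero]
      ring
  refine hwave.exists_effective_gt hj (fun ω => ?_) (fun ω => ?_) ?_ ?_ (Real.cos_le_one _) ?_
  · simp only [β, reflect_apply_zero, reflect_apply_ne ω hj, wave_sin_reflect]
    ring
  · simp only [β, abs_mul]
    exact mul_le_one₀ (Real.abs_sin_le_one _) (abs_nonneg _) (Real.abs_cos_le_one _)
  · refine Function.ne_iff.2 ⟨0, ?_⟩
    have h1 : 0 < Real.sin (Real.pi / L 0) := Real.sin_pos_of_pos_of_lt_pi (by positivity)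
      ((div_lt_self hπ (by linarith)))
    simp [β, wave, h1.ne']
  -- This is where the period 6 enters: cos(2π/L₁) ≥ 1/2 = cos(π/3).
  · rw [← Real.cos_pi_div_three]
    refine Real.cos_le_cos_of_nonneg_of_le_pi (by positivity) (by linarith) ?_
    rw [Nat.cast_one, mul_one, div_le_div_iff₀ (by linarith) (by norm_num)]
    nlinarith
  · have h1 : L j < 4 * k := by omega
    have h2 : 2 * k ≤ L j := by omega
    have h1' : (L j : ℝ) < 4 * k := by exact_mod_cast h1
    have h2' : 2 * (k : ℝ) ≤ L j := by exact_mod_cast h2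
    have hLpos : (0 : ℝ) < L j := by linarith
    refine Real.cos_neg_of_pi_div_two_lt_of_lt ?_ ?_
    · rw [div_lt_div_iff₀ (by norm_num) hLpos]
      nlinarith
    · rw [div_lt_iff₀ hLpos]
      nlinarith

end Perturbation

end Homogenization

theorem theorem1p2 (d : ℕ) [NeZero d] (L : Fin d → ℕ) [∀ i, NeZero (L i)] :
    -- the effective coefficient `q(b)` is well defined
    (∀ b : Homogenization.Torus L → ℝ, Homogenization.IsAdmissible L b →
      ∃! q : ℝ, Homogenization.IsEffectiveCoefficient L b q) ∧
    -- (a)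
    (d = 1 → ∀ (b : Homogenization.Torus L → ℝ) (q : ℝ), Homogenization.IsAdmissible L b →
      Homogenization.IsEffectiveCoefficient L b q → q ≤ 1 / 2) ∧
    -- (b)
    (L 0 = 2 → ∀ (b : Homogenization.Torus L → ℝ) (q : ℝ), Homogenization.IsAdmissible L b →
      Homogenization.IsEffectiveCoefficient L b q → q ≤ 1 / (2 * (d : ℝ))) ∧
    -- (c)
    (d = 2 → L 0 = 4 → ∀ (b : Homogenization.Torus L → ℝ) (q : ℝ),
      Homogenization.IsAdmissible L b →
      Homogenization.IsEffectiveCoefficient L b q → q ≤ 1 / 4) ∧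
    -- (d)
    (2 ≤ d → 6 ≤ L 0 → Even (L 0) → (∃ j : Fin d, j ≠ 0 ∧ 2 ≤ L j) →
      ∃ (b : Homogenization.Torus L → ℝ) (q : ℝ), Homogenization.IsAdmissible L b ∧
        Homogenization.IsEffectiveCoefficient L b q ∧ 1 / (2 * (d : ℝ)) < q) := by
  refine ⟨fun b hb => Homogenization.existsUnique_isEffectiveCoefficient hb, ?_, ?_, ?_, ?_⟩
  · intro hd b q hb hq
    obtain ⟨ψ, χ, h⟩ := hq.exists_isCorrector hb
    exact h.le_of_dim_one hb hd
  · intro hL b q hb hq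
    obtain ⟨ψ, χ, h⟩ := hq.exists_isCorrector hb
    exact h.le_of_period_two hL
  · intro hd hL b q hb hq
    obtain ⟨ψ, χ, h⟩ := hq.exists_isCorrector hb
    have := h.le_of_period_four hb hL
    rw [hd] at this
    norm_num at this ⊢
    exact this
  · rintro - hL0 - ⟨j, hj, hLj⟩
    exact Homogenization.exists_effective_gt hL0 hj hLj
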